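/- Let $s,b\in\mathbb R$ with $27s-38b^2>0$ and $b\neq 0$, let $\varepsilon>0$ and $\omega\in(-\tfrac12,\tfrac12)$ with $1+2\varepsilon\omega>0$, and let $\tilde u=\tilde u(x)$ be a roll, that is, an even, $2\pi$-periodic, real-valued $C^4$ function solving $$-(1+(1+2\varepsilon\omega)\partial_x^2)^2\tilde u+\varepsilon^2\tilde u+b\tilde u^2-s\tilde u^3=0 .$$ Let $$\mathcal L=-(1+(1+2\varepsilon\omega)\partial_x^2+\partial_y^2)^2+\varepsilon^2+2b\tilde u-3s\tilde u^2$$ act on $L^2(\mathbb R^2;\mathbb C)$ with domain $H^4(\mathbb R^2)$, and for $\sigma=(\sigma_1,\sigma_2)\in\mathbb R^2$ let $$B(\sigma)=-\big[1+(1+2\varepsilon\omega)(\partial_x+i\sigma_1)^2-\sigma_2^2\big]^2+\varepsilon^2+2b\tilde u-3s\tilde u^2$$ act on $L^2(\mathbb T;\mathbb C)$, $\mathbb T=\mathbb R/2\pi\mathbb Z$, with domain $H^4(\mathbb T)$. Then the set of all (real) eigenvalues of the operators $B(\sigma)$, $\sigma\in\mathbb R^2$, is non-empty and bounded above; let $\lambda_M$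 be its supremum (the maximal growth rate, equal to the largest eigenvalue when it is attained). The operator $\mathcal L$ generates a strongly continuous semigroup $(e^{t\mathcal L})_{t\ge 0}$ on $L^2(\mathbb R^2)$, this semigroup maps $H^2(\mathbb R^2)$ into itself, and there is a constant $C$ (which may depend on $s,b,\varepsilon,\omega,\tilde u$, but not on $t$ or $w$) such that $$\|e^{t\mathcal L}w\|_{H^2(\mathbb R^2)}\le C e^{\lambda_M t}\|w\|_{H^2(\mathbb R^2)}\qquad\text{for all } t\ge 0 \text{ and all } w\in H^2(\mathbb R^2).$$ -/

import Mathlib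

open MeasureTheory Filter Topology
open scoped NNReal ENNReal SchwartzMap LineDeriv

noncomputable section

namespace SwiftHohenberg

/-! ### Roll solutions -/

/-- `u` is a roll profile: an even, `2π`-periodic stationary solution, depending on `x` only, of
`∂ₜ u = -(1 + (1 + 2εω)∂ₓ² + ∂_y²)² u + ε² u + b u² - s u³`. -/
structure IsRoll (s b ε ω : ℝ) (u : ℝ → ℝ) : Prop where
  contDiff : ContDiff ℝ 4 u
  periodic : Function.Periodic u (2 * Real.pi)
  even : ∀ x, u (-x) = u x
  stationary : ∀ x,
    -(u x + 2 * (1 + 2 * ε * ω) * iteratedDeriv 2 u x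
        + (1 + 2 * ε * ω) ^ 2 * iteratedDeriv 4 u x)
      + ε ^ 2 * u x + b * u x ^ 2 - s * u x ^ 3 = 0

/-- The zeroth-order coefficient `ε² + 2b u - 3s u²` of the linearization about `u`. -/
def potential (s b ε : ℝ) (u : ℝ → ℝ) (x : ℝ) : ℝ :=
  ε ^ 2 + 2 * b * u x - 3 * s * u x ^ 2

/-! ### The plane: Sobolev spaces and the linearized operator -/

/-- The plane with coordinates `(x, y) = (z 0, z 1)`. -/
abbrev Plane : Type := EuclideanSpace ℝ (Fin 2)

/-- `L²(ℝ²; ℂ)`. -/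
abbrev L2Plane : Type := Lp ℂ 2 (volume : Measure Plane)

/-- `w ∈ Hᵖ(ℝ²)`, for `w ∈ L²(ℝ²)`. -/
def MemH (p : ℝ) (w : L2Plane) : Prop :=
  TemperedDistribution.MemSobolev p 2 (w : 𝓢'(Plane, ℂ))

open Classical in
/-- The norm of `Hᵖ(ℝ²)`: the `L²` norm of the (unique) `L²` function that represents the
Bessel potential of order `p` of `w`, that is, of `(1 + |ξ|²)^(p/2) ŵ(ξ)`. Only meaningful for
`w ∈ Hᵖ(ℝ²)`; set to `0` otherwise. -/
def normH (p : ℝ) (w : L2Plane) : ℝ :=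
  if h : MemH p w then ‖h.choose‖ else 0

/-- The operator `1 + (1 + 2εω)∂ₓ² + ∂_y²` on tempered distributions. -/
def opA (ε ω : ℝ) (f : 𝓢'(Plane, ℂ)) : 𝓢'(Plane, ℂ) :=
  f + ((1 + 2 * ε * ω : ℝ) : ℂ) •
      ∂_{EuclideanSpace.single (0 : Fin 2) (1 : ℝ)}
        (∂_{EuclideanSpace.single (0 : Fin 2) (1 : ℝ)} f)
    + ∂_{EuclideanSpace.single (1 : Fin 2) (1 : ℝ)}
        (∂_{EuclideanSpace.single (1 : Fin 2) (1 : ℝ)} f)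

/-- The graph of the linearized operator
`ℒ = -(1 + (1 + 2εω)∂ₓ² + ∂_y²)² + ε² + 2b u - 3s u²` on `L²(ℝ²)` with domain `H⁴(ℝ²)`:
`w ∈ H⁴(ℝ²)` and `ℒ w = g`. The function `q` is the product of the potential with `w`. -/
def LinearizedGraph (s b ε ω : ℝ) (u : ℝ → ℝ) (w g : L2Plane) : Prop :=
  MemH 4 w ∧ ∃ q : L2Plane,
    (∀ᵐ z : Plane, q z = (potential s b ε u (z 0) : ℂ) * w z) ∧
    (g : 𝓢'(Plane, ℂ)) = -opA ε ω (opA ε ω (w : 𝓢'(Plane, ℂ))) + (q : 𝓢'(Plane, ℂ))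

/-! ### Strongly continuous semigroups -/

/-- `T` is a strongly continuous one-parameter semigroup of bounded operators on `X`. -/
structure IsC0Semigroup {X : Type*} [NormedAddCommGroup X] [NormedSpace ℂ X]
    (T : ℝ≥0 → X →L[ℂ] X) : Prop where
  zero : T 0 = ContinuousLinearMap.id ℂ X
  add : ∀ t r, T (t + r) = (T t).comp (T r)
  continuous : ∀ w, Continuous fun t => T t w

/-- The graph of the infinitesimal generator of `T`: the right derivative of `t ↦ T t w` at
`t = 0` exists and equals `g`. -/
def GeneratorGraph {X : Type*} [NormedAddCommGroup X] [NormedSpace ℂ X]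
    (T : ℝ≥0 → X →L[ℂ] X) (w g : X) : Prop :=
  Tendsto (fun t : ℝ≥0 => ((t : ℝ)⁻¹ : ℂ) • (T t w - w)) (𝓝[>] 0) (𝓝 g)

/-- `T t = e^{tℒ}`: `T` is the strongly continuous semigroup on `L²(ℝ²)` whose generator is
exactly `ℒ`, domain included. -/
def IsLinearizedSemigroup (s b ε ω : ℝ) (u : ℝ → ℝ) (T : ℝ≥0 → L2Plane →L[ℂ] L2Plane) : Prop :=
  IsC0Semigroup T ∧ ∀ w g, GeneratorGraph T w g ↔ LinearizedGraph s b ε ω u w g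

/-! ### Bloch operators on the circle -/

instance factTwoPiPos : Fact (0 < 2 * Real.pi) := ⟨Real.two_pi_pos⟩

/-- The circle `𝕋 = ℝ / 2πℤ`. -/
abbrev Circle2Pi : Type := AddCircle (2 * Real.pi)

/-- `L²(𝕋; ℂ)`. -/
abbrev L2Circle : Type := Lp ℂ 2 (AddCircle.haarAddCircle (T := 2 * Real.pi))

/-- `W ∈ H⁴(𝕋)`. -/
def MemH4Circle (W : L2Circle) : Prop :=
  Summable fun n : ℤ => (1 + (n : ℝ) ^ 2) ^ 4 * ‖fourierCoeff W n‖ ^ 2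

/-- The symbol of `-[1 + (1 + 2εω)(∂ₓ + iσ₁)² - σ₂²]²` at `e^{inx}`, where `∂ₓ` acts as `in`. -/
def blochSymbol (ε ω : ℝ) (σ : ℝ × ℝ) (n : ℤ) : ℂ :=
  -(1 + ((1 + 2 * ε * ω : ℝ) : ℂ) * (Complex.I * n + Complex.I * σ.1) ^ 2 - (σ.2 : ℂ) ^ 2) ^ 2

/-- The graph of the Bloch operator
`B(σ) = -[1 + (1 + 2εω)(∂ₓ + iσ₁)² - σ₂²]² + ε² + 2b u - 3s u²` on `L²(𝕋)` with domain `H⁴(𝕋)`: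
`W ∈ H⁴(𝕋)` and `B(σ) W = G`, the equation being written in Fourier coefficients. The function
`Q` is the product of the potential with `W`. -/
def BlochGraph (s b ε ω : ℝ) (u : ℝ → ℝ) (σ : ℝ × ℝ) (W G : L2Circle) : Prop :=
  MemH4Circle W ∧ ∃ Q : L2Circle,
    (∀ᵐ θ ∂(AddCircle.haarAddCircle (T := 2 * Real.pi)),
      Q θ = ((AddCircle.liftIco (2 * Real.pi) 0 (potential s b ε u) θ : ℝ) : ℂ) * W θ) ∧
    ∀ n : ℤ, fourierCoeff G n = blochSymbol ε ω σ n * fourierCoeff W n + fourierCoeff Q n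

/-- The eigenvalues of all the Bloch operators `B(σ)`, `σ ∈ ℝ²`; they are real since each `B(σ)`
is self-adjoint. -/
def blochEigenvalues (s b ε ω : ℝ) (u : ℝ → ℝ) : Set ℝ :=
  {μ | ∃ σ : ℝ × ℝ, ∃ W : L2Circle, W ≠ 0 ∧ BlochGraph s b ε ω u σ W ((μ : ℂ) • W)}

/-- The maximal growth rate `λ_M`: the supremum of the eigenvalues of the Bloch operators over all
`σ ∈ ℝ²`, which is the largest eigenvalue when it is attained. -/
def maxGrowthRate (s b ε ω : ℝ) (u : ℝ → ℝ) : ℝ :=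
  sSup (blochEigenvalues s b ε ω u)

end SwiftHohenberg

end

/-! Choose `κ > 0` larger than the supremum norm of the potential `V = ε² + 2bu - 3su²`. With
`a = 1 - (1 + 2εω)ξ₁² - ξ₂²` and `N` the Fourier multiplier `(a² + κ)^(-1/2)`, we have
`κ - ℒ = N⁻¹ (1 - N V N) N⁻¹`, where `1 - N V N` is positive and invertible. So
`R = (κ - ℒ)⁻¹ = N (1 - N V N)⁻¹ N` is positive and injective, and `e^{tℒ}` is `e^{κt}` times the
function `r ↦ e^{-t/r}` of `R`. The range of `N` is `H²(ℝ²)`, and `R = X X⋆` with `X = N S⁻¹` for an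
invertible `S`. Since `f(X X⋆) X = X f(X⋆ X)`, the semigroup acts on `H²(ℝ²)` through a function of
`X⋆ X`, whose norm is again `‖R‖`; hence the growth rates on `L²(ℝ²)` and `H²(ℝ²)` coincide and are
at most `κ - 1 / ‖R‖`.

It remains to see that `‖R‖ ≤ (κ - λ_M)⁻¹`, that is, `⟨w, V w⟩ ≤ ∫ (a² + λ_M) |ŵ|²`. The resolvent
of `B(σ)` is compact and positive, so its norm is an eigenvalue, which gives the analogous form
inequality on the circle. Sampling `ŵ` along a lattice of frequencies, on which `V` acts as in the
Bloch operator, and averaging over long windows of lattice translates transfers it to the plane.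
-/

noncomputable section

namespace SwiftHohenberg

open scoped BoundedContinuousFunction ComplexConjugate FourierTransform Ring

/-! ### Semigroups generated by negative operators -/

section Intertwining

variable {A : Type*} [CStarAlgebra A] {a b x : A}

theorem semiconjBy_aeval (h : SemiconjBy x a b) (p : Polynomial ℝ) :
    SemiconjBy x (Polynomial.aeval a p) (Polynomial.aeval b p) := by
  induction p using Polynomial.induction_on with
  | C r =>
    rw [Polynomial.aeval_C, Polynomial.aeval_C]
    exact Algebra.commute_algebraMap_right r x
  | add p q hp hq => simpa only [map_add] using hp.add_right hq
  | monomial n r _ =>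
    rw [map_mul, map_mul, map_pow, map_pow,
      Polynomial.aeval_C, Polynomial.aeval_C, Polynomial.aeval_X, Polynomial.aeval_X]
    exact SemiconjBy.mul_right (Algebra.commute_algebraMap_right r x) (h.pow_right (n + 1))

theorem semiconjBy_cfc (ha : IsSelfAdjoint a) (hb : IsSelfAdjoint b) (h : SemiconjBy x a b)
    {f : ℝ → ℝ} (hf : Continuous f) : SemiconjBy x (cfc f a) (cfc f b) := by
  set M := max ‖a‖ ‖b‖
  rw [SemiconjBy, ← sub_eq_zero, ← norm_le_zero_iff]
  refine le_of_forall_pos_le_add fun ε hε => ?_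
  obtain ⟨p, hp⟩ := exists_polynomial_near_of_continuousOn (-M) M f hf.continuousOn
    (ε / (2 * (‖x‖ + 1))) (by positivity)
  have hcfc : ∀ c : A, IsSelfAdjoint c → ‖c‖ ≤ M →
      ‖cfc f c - Polynomial.aeval c p‖ ≤ ε / (2 * (‖x‖ + 1)) := fun c hc hcM => by
    rw [← cfc_polynomial p c, ← cfc_sub f p.eval c]
    refine norm_cfc_le (by positivity) fun r hr => ?_
    rw [norm_sub_rev]
    rcases subsingleton_or_nontrivial A
    · simp [spectrum.of_subsingleton] at hr
    · exact (hp r (abs_le.1 ((spectrum.norm_le_norm_of_mem hr).trans hcM))).le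
  calc ‖x * cfc f a - cfc f b * x‖
      = ‖x * (cfc f a - Polynomial.aeval a p) - (cfc f b - Polynomial.aeval b p) * x‖ := by
        rw [mul_sub, sub_mul, (semiconjBy_aeval h p).eq, sub_sub_sub_cancel_right]
    _ ≤ ‖x‖ * (ε / (2 * (‖x‖ + 1))) + ε / (2 * (‖x‖ + 1)) * ‖x‖ := by
        refine (norm_sub_le _ _).trans (add_le_add ?_ ?_)
        · exact norm_mul_le_of_le le_rfl (hcfc a ha (le_max_left _ _))
        · exact norm_mul_le_of_le (hcfc b hb (le_max_right _ _)) le_rfl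
    _ ≤ 0 + ε := by
        field_simp
        nlinarith [norm_nonneg x]

end Intertwining

section C0Semigroup

open Set

variable {X : Type*} [NormedAddCommGroup X] [NormedSpace ℂ X]

theorem hasDerivWithinAt_comp_toNNReal {f : ℝ≥0 → X} {f' : X} {r : ℝ≥0} :
    HasDerivWithinAt (fun t : ℝ => f t.toNNReal) f' (Ici r) r ↔
      Tendsto (fun t : ℝ≥0 => ((t : ℝ)⁻¹ : ℂ) • (f (r + t) - f r)) (𝓝[>] 0) (𝓝 f') := by
  have hmap : 𝓝[>] (r : ℝ) = map (fun t : ℝ≥0 => (r : ℝ) + t) (𝓝[>] 0) := by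
    conv_lhs => rw [← add_zero (r : ℝ), ← map_add_left_nhdsGT, ← NNReal.coe_zero,
      ← NNReal.map_coe_nhdsGT, map_map]
    rfl
  rw [← hasDerivWithinAt_Ioi_iff_Ici, hasDerivWithinAt_iff_tendsto_slope' self_notMem_Ioi, hmap,
    tendsto_map'_iff]
  refine tendsto_congr fun t => ?_
  rw [Function.comp_apply, slope_def_module, add_sub_cancel_left, ← NNReal.coe_add,
    Real.toNNReal_coe, Real.toNNReal_coe, ← Complex.ofReal_inv, Complex.coe_smul]

variable {T : ℝ≥0 → X →L[ℂ] X} {w g : X}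

theorem generatorGraph_iff_hasDerivWithinAt (hT : T 0 = .id ℂ X) :
    GeneratorGraph T w g ↔ HasDerivWithinAt (fun t : ℝ => T t.toNNReal w) g (Ici 0) 0 := by
  rw [← NNReal.coe_zero, hasDerivWithinAt_comp_toNNReal (f := fun t => T t w), hT]
  simp only [zero_add, ContinuousLinearMap.id_apply, GeneratorGraph]

theorem GeneratorGraph.map_of_commute (h : GeneratorGraph T w g) {A : X →L[ℂ] X}
    (hA : ∀ t, Commute (T t) A) : GeneratorGraph T (A w) (A g) := by
  refine ((A.continuous.tendsto g).comp h).congr fun t => ?_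
  have hcomm : A (T t w) = T t (A w) := DFunLike.congr_fun (hA t).symm.eq w
  rw [Function.comp_apply, map_smul, map_sub, hcomm]

namespace IsC0Semigroup

theorem commute (hT : IsC0Semigroup T) (t r : ℝ≥0) : Commute (T t) (T r) := by
  change (T t).comp (T r) = (T r).comp (T t)
  rw [← hT.add, ← hT.add, add_comm]

theorem continuous_orbit (hT : IsC0Semigroup T) (w : X) :
    Continuous fun t : ℝ => T t.toNNReal w :=
  (hT.continuous w).comp continuous_real_toNNReal

theorem hasDerivWithinAt_orbit (hT : IsC0Semigroup T) (h : GeneratorGraph T w g) {r : ℝ}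
    (hr : 0 ≤ r) :
    HasDerivWithinAt (fun t : ℝ => T t.toNNReal w) (T r.toNNReal g) (Ici r) r := by
  lift r to ℝ≥0 using hr
  rw [hasDerivWithinAt_comp_toNNReal (f := fun t => T t w), Real.toNNReal_coe]
  refine (((T r).continuous.tendsto g).comp h).congr fun t => ?_
  rw [Function.comp_apply, map_smul, map_sub, hT.add, ContinuousLinearMap.comp_apply]

theorem exp_smul (hT : IsC0Semigroup T) (κ : ℝ) :
    IsC0Semigroup fun t : ℝ≥0 => Real.exp (κ * t) • T t where
  zero := by simp [hT.zero]
  add t r := by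
    rw [hT.add, NNReal.coe_add, mul_add, Real.exp_add, ContinuousLinearMap.smul_comp,
      ContinuousLinearMap.comp_smul, smul_smul]
  continuous w := by
    have := hT.continuous w
    simp only [_root_.smul_apply]
    fun_prop

end IsC0Semigroup

theorem GeneratorGraph.exp_smul (hT : T 0 = .id ℂ X) (h : GeneratorGraph T w g) (κ : ℝ) :
    GeneratorGraph (fun t : ℝ≥0 => Real.exp (κ * t) • T t) w (g + κ • w) := by
  have hexp : HasDerivAt (fun t : ℝ => Real.exp (κ * t)) κ 0 := by
    simpa using ((hasDerivAt_id (0 : ℝ)).const_mul κ).exp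
  rw [generatorGraph_iff_hasDerivWithinAt hT] at h
  rw [generatorGraph_iff_hasDerivWithinAt (by simp [hT])]
  have hderiv := hexp.hasDerivWithinAt.smul h
  simp only [mul_zero, Real.exp_zero, one_smul, Real.toNNReal_zero, hT,
    ContinuousLinearMap.id_apply] at hderiv
  refine hderiv.congr (fun t ht => ?_) (by simp [hT])
  rw [_root_.smul_apply, Real.coe_toNNReal t ht]
  rfl

theorem generatorGraph_exp_smul_iff (hT : T 0 = .id ℂ X) (κ : ℝ) :
    GeneratorGraph (fun t : ℝ≥0 => Real.exp (κ * t) • T t) w g ↔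
      GeneratorGraph T w (g - κ • w) := by
  refine ⟨fun h => ?_, fun h => by simpa using h.exp_smul hT κ⟩
  have := h.exp_smul (by simp [hT]) (-κ)
  simpa [smul_smul, ← Real.exp_add, ← sub_eq_add_neg] using this

end C0Semigroup

section Uniqueness

variable {H : Type*} [NormedAddCommGroup H] [InnerProductSpace ℂ H] {T S : ℝ≥0 → H →L[ℂ] H}
  {R : H →L[ℂ] H}

theorem IsC0Semigroup.commute_of_generatorGraph (hT : IsC0Semigroup T)
    (hgen : ∀ w g, GeneratorGraph T w g ↔ w = R (-g)) (t : ℝ≥0) : Commute (T t) R := by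
  ext x
  have h : GeneratorGraph T (R x) (-x) := (hgen _ _).2 (by rw [neg_neg])
  simpa using (hgen _ _).1 (h.map_of_commute (A := T t) fun r => hT.commute r t)

open Set in
theorem norm_le_of_re_inner_deriv_right_nonpos {f f' : ℝ → H} {a b : ℝ} (hab : a ≤ b)
    (hf : ContinuousOn f (Icc a b))
    (hf' : ∀ t ∈ Ico a b, HasDerivWithinAt f (f' t) (Ici t) t)
    (hre : ∀ t ∈ Ico a b, (inner ℂ (f t) (f' t)).re ≤ 0) : ‖f b‖ ≤ ‖f a‖ := by
  have hderiv : ∀ t ∈ Ico a b,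
      HasDerivWithinAt (fun t => ‖f t‖ ^ 2) (2 * (inner ℂ (f t) (f' t)).re) (Ici t) t :=
    fun t ht => by
      let := InnerProductSpace.rclikeToReal ℂ H
      exact (hf' t ht).norm_sq
  have hsq : ‖f b‖ ^ 2 ≤ ‖f a‖ ^ 2 :=
    image_le_of_deriv_right_le_deriv_boundary (hf.norm.pow 2) hderiv (B := fun _ => ‖f a‖ ^ 2)
      le_rfl continuousOn_const (fun t _ => hasDerivWithinAt_const t _ _)
      (fun t ht => by linarith [hre t ht]) ⟨hab, le_rfl⟩
  exact le_of_sq_le_sq hsq (norm_nonneg _)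

theorem IsC0Semigroup.eq_of_generatorGraph (hT : IsC0Semigroup T) (hS : IsC0Semigroup S)
    (hR : R.IsPositive) (hinj : Function.Injective R)
    (hTgen : ∀ w g, GeneratorGraph T w g ↔ w = R (-g))
    (hSgen : ∀ w g, GeneratorGraph S w g ↔ w = R (-g)) : T = S := by
  funext t
  ext x
  let d : ℝ → H := fun r => T r.toNNReal x - S r.toNNReal x
  have hRd : ∀ r : ℝ, R (d r) = T r.toNNReal (R x) - S r.toNNReal (R x) := fun r => by
    have hTR := DFunLike.congr_fun (hT.commute_of_generatorGraph hTgen r.toNNReal).eq x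
    have hSR := DFunLike.congr_fun (hS.commute_of_generatorGraph hSgen r.toNNReal).eq x
    simp only [mul_apply_eq_comp] at hTR hSR
    rw [hTR, hSR, map_sub]
  have hderiv : ∀ r ∈ Set.Ico (0 : ℝ) t, HasDerivWithinAt (fun r => R (d r)) (-d r) (Set.Ici r) r :=
    fun r hr => by
      simp only [hRd]
      refine ((hT.hasDerivWithinAt_orbit ((hTgen (R x) (-x)).2 (by simp)) hr.1).sub
        (hS.hasDerivWithinAt_orbit ((hSgen (R x) (-x)).2 (by simp)) hr.1)).congr_deriv ?_
      simp only [d, map_neg, neg_sub_neg, neg_sub]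
  have hbound := norm_le_of_re_inner_deriv_right_nonpos t.2
    (R.continuous.comp ((hT.continuous_orbit x).sub (hS.continuous_orbit x))).continuousOn
    hderiv fun r _ => by
      rw [inner_neg_right, Complex.neg_re, neg_nonpos]
      exact hR.re_inner_nonneg_left (d r)
  have hzero : R (d t) = 0 := by
    simpa [d, hT.zero, hS.zero] using hbound
  simpa [d, sub_eq_zero] using hinj (hzero.trans (map_zero R).symm)

end Uniqueness

section HeatSymbol

/-- The function `r ↦ exp (-t / r)`, extended by its limit `0` to `r ≤ 0` when `0 < t`, and
constantly `1` when `t = 0`. It is continuous on `ℝ`, so the continuous functional calculus turns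
it into `exp (-t R⁻¹)` even where `0` belongs to the spectrum of `R`. -/
def heatSymbol (t : ℝ≥0) (r : ℝ) : ℝ :=
  if t = 0 then 1 else expNegInvGlue (r / t)

@[fun_prop]
theorem continuous_heatSymbol (t : ℝ≥0) : Continuous (heatSymbol t) := by
  unfold heatSymbol
  split_ifs
  · exact continuous_const
  · exact (expNegInvGlue.contDiff (n := 0)).continuous.comp (continuous_id.div_const _)

theorem heatSymbol_zero (r : ℝ) : heatSymbol 0 r = 1 :=
  if_pos rfl

theorem heatSymbol_of_pos (t : ℝ≥0) {r : ℝ} (hr : 0 < r) :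
    heatSymbol t r = Real.exp (-(t / r)) := by
  rcases eq_or_ne t 0 with rfl | ht
  · simp [heatSymbol_zero]
  · have ht' : (0 : ℝ) < t := NNReal.coe_pos.2 (pos_iff_ne_zero.2 ht)
    rw [heatSymbol, if_neg ht, expNegInvGlue, if_neg (div_pos hr ht').not_ge, inv_div]

theorem heatSymbol_of_nonpos {t : ℝ≥0} (ht : t ≠ 0) {r : ℝ} (hr : r ≤ 0) : heatSymbol t r = 0 := by
  rw [heatSymbol, if_neg ht]
  exact expNegInvGlue.zero_of_nonpos (div_nonpos_of_nonpos_of_nonneg hr t.2)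

theorem heatSymbol_add (t t' : ℝ≥0) (r : ℝ) :
    heatSymbol (t + t') r = heatSymbol t r * heatSymbol t' r := by
  rcases eq_or_ne t 0 with rfl | ht
  · simp [heatSymbol_zero]
  rcases lt_or_ge 0 r with hr | hr
  · rw [heatSymbol_of_pos _ hr, heatSymbol_of_pos _ hr, heatSymbol_of_pos _ hr, ← Real.exp_add,
      NNReal.coe_add, add_div, neg_add]
  · rw [heatSymbol_of_nonpos (by simp [ht]) hr, heatSymbol_of_nonpos ht hr, zero_mul]

theorem abs_heatSymbol_le (t : ℝ≥0) {r ρ : ℝ} (hr : r ≤ ρ) :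
    |heatSymbol t r| ≤ Real.exp (-(t / ρ)) := by
  rcases eq_or_ne t 0 with rfl | ht
  · simp [heatSymbol_zero]
  rcases lt_or_ge 0 r with hr0 | hr0
  · rw [heatSymbol_of_pos _ hr0, Real.abs_exp]
    gcongr
  · rw [heatSymbol_of_nonpos ht hr0, abs_zero]
    positivity

theorem abs_heatSymbol_le_one (t : ℝ≥0) (r : ℝ) : |heatSymbol t r| ≤ 1 :=
  (abs_heatSymbol_le t (le_max_left r 0)).trans
    (Real.exp_le_one_iff.2 (neg_nonpos.2 (by positivity)))

theorem abs_exp_neg_sub_exp_neg_le {x y : ℝ} (hx : 0 ≤ x) (hy : 0 ≤ y) :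
    |Real.exp (-x) - Real.exp (-y)| ≤ |x - y| := by
  wlog hxy : x ≤ y generalizing x y
  · rw [abs_sub_comm, abs_sub_comm x]
    exact this hy hx (le_of_not_ge hxy)
  have hle : Real.exp (-y) ≤ Real.exp (-x) := by gcongr
  have hone : Real.exp (-x) ≤ 1 := Real.exp_le_one_iff.2 (neg_nonpos.2 hx)
  have htangent : x - y + 1 ≤ Real.exp (x - y) := Real.add_one_le_exp _
  have hexp : Real.exp (-y) = Real.exp (-x) * Real.exp (x - y) := by
    rw [← Real.exp_add]; ring_nf
  rw [abs_of_nonneg (sub_nonneg.2 hle), abs_of_nonpos (sub_nonpos.2 hxy), hexp]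
  nlinarith [Real.exp_pos (-x)]

theorem abs_exp_neg_sub_one_add_le {x : ℝ} (hx : 0 ≤ x) : |Real.exp (-x) - 1 + x| ≤ x ^ 2 := by
  rcases le_total x 1 with hx1 | hx1
  · simpa using Real.abs_exp_sub_one_sub_id_le (x := -x) (by rwa [abs_neg, abs_of_nonneg hx])
  · have htangent : -x + 1 ≤ Real.exp (-x) := Real.add_one_le_exp _
    have hone : Real.exp (-x) ≤ 1 := Real.exp_le_one_iff.2 (neg_nonpos.2 hx)
    rw [abs_of_nonneg (by linarith)]
    nlinarith

theorem abs_heatSymbol_sub_mul_le (t t' : ℝ≥0) {r : ℝ} (hr : 0 ≤ r) :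
    |(heatSymbol t r - heatSymbol t' r) * r| ≤ |(t : ℝ) - t'| := by
  rcases hr.eq_or_lt with rfl | hr
  · simp
  rw [heatSymbol_of_pos _ hr, heatSymbol_of_pos _ hr, abs_mul, abs_of_pos hr, ← le_div_iff₀ hr]
  refine (abs_exp_neg_sub_exp_neg_le (by positivity) (by positivity)).trans_eq ?_
  rw [← sub_div, abs_div, abs_of_pos hr]

theorem abs_heatSymbol_sub_one_mul_add_mul_le (t : ℝ≥0) {r : ℝ} (hr : 0 ≤ r) :
    |((heatSymbol t r - 1) * r + t) * r| ≤ t ^ 2 := by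
  rcases hr.eq_or_lt with rfl | hr
  · simp
  have hfactor : ((heatSymbol t r - 1) * r + t) * r =
      (Real.exp (-(t / r)) - 1 + t / r) * r ^ 2 := by
    rw [heatSymbol_of_pos _ hr]
    field_simp
  rw [hfactor, abs_mul, abs_of_nonneg (sq_nonneg r), ← le_div_iff₀ (by positivity), ← div_pow]
  exact abs_exp_neg_sub_one_add_le (by positivity)

end HeatSymbol

section HeatSemigroup

variable {H : Type*} [NormedAddCommGroup H] [InnerProductSpace ℂ H]

theorem denseRange_of_isSelfAdjoint [CompleteSpace H] {R : H →L[ℂ] H}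
    (hR : IsSelfAdjoint R) (hinj : Function.Injective R) : DenseRange R := by
  have hrange : R.rangeᗮ = ⊥ := by
    rw [ContinuousLinearMap.orthogonal_range, hR.adjoint_eq]
    exact LinearMap.ker_eq_bot.2 hinj
  exact (Submodule.dense_iff_topologicalClosure_eq_top).2
    ((Submodule.topologicalClosure_eq_top_iff (K := R.range)).2 hrange)

theorem tendsto_apply_of_denseRange {ι : Type*} {l : Filter ι} {A : ι → H →L[ℂ] H}
    {B R : H →L[ℂ] H} {C : ℝ} (hA : ∀ i, ‖A i‖ ≤ C) (hR : DenseRange R)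
    (h : ∀ x, Tendsto (fun i => A i (R x)) l (𝓝 (B (R x)))) (x : H) :
    Tendsto (fun i => A i x) l (𝓝 (B x)) := by
  have hequi : Equicontinuous ((↑) ∘ A : ι → H → H) :=
    ((NormedSpace.equicontinuous_TFAE A).out 5 1 : (∃ C, ∀ i, ‖A i‖ ≤ C) ↔ _).1 ⟨C, hA⟩
  exact hR.induction_on (p := fun x => Tendsto (fun i => A i x) l (𝓝 (B x))) x
    (hequi.isClosed_setOfPred_tendsto B.continuous) h

variable [CompleteSpace H] {R : H →L[ℂ] H}

/-- The semigroup `exp (-t R⁻¹)` generated by `-R⁻¹`, for a positive injective operator `R`. -/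
def heatSemigroup (R : H →L[ℂ] H) (t : ℝ≥0) : H →L[ℂ] H :=
  cfc (heatSymbol t) R

theorem le_norm_of_mem_spectrum {r : ℝ} (hr : r ∈ spectrum ℝ R) : r ≤ ‖R‖ := by
  rcases subsingleton_or_nontrivial (H →L[ℂ] H) with h | h
  · simp [spectrum.of_subsingleton] at hr
  · exact (le_abs_self r).trans (spectrum.norm_le_norm_of_mem hr)

theorem norm_heatSemigroup_le {ρ : ℝ} (hRρ : ‖R‖ ≤ ρ) (t : ℝ≥0) :
    ‖heatSemigroup R t‖ ≤ Real.exp (-(t / ρ)) :=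
  norm_cfc_le (Real.exp_nonneg _) fun _ hr =>
    abs_heatSymbol_le t ((le_norm_of_mem_spectrum hr).trans hRρ)

theorem norm_heatSemigroup_le_one (t : ℝ≥0) : ‖heatSemigroup R t‖ ≤ 1 :=
  norm_cfc_le zero_le_one fun r _ => abs_heatSymbol_le_one t r

theorem commute_heatSemigroup (hR : 0 ≤ R) (t : ℝ≥0) : Commute (heatSemigroup R t) R := by
  have hsa : IsSelfAdjoint R := .of_nonneg hR
  simpa only [heatSemigroup, cfc_id ℝ R] using cfc_commute_cfc (heatSymbol t) (id : ℝ → ℝ) R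

theorem norm_heatSemigroup_sub_mul_le (hR : 0 ≤ R) (t t' : ℝ≥0) :
    ‖(heatSemigroup R t - heatSemigroup R t') * R‖ ≤ |(t : ℝ) - t'| := by
  have hsa : IsSelfAdjoint R := .of_nonneg hR
  have hcfc : (heatSemigroup R t - heatSemigroup R t') * R =
      cfc (fun r => (heatSymbol t r - heatSymbol t' r) * r) R := by
    rw [cfc_mul _ _ R, cfc_sub _ _ R, cfc_id' ℝ R, heatSemigroup, heatSemigroup]
  rw [hcfc]
  exact norm_cfc_le (abs_nonneg _) fun r hr =>
    abs_heatSymbol_sub_mul_le t t' (spectrum_nonneg_of_nonneg hR hr)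

theorem norm_heatSemigroup_sub_one_mul_add_mul_le (hR : 0 ≤ R) (t : ℝ≥0) :
    ‖((heatSemigroup R t - 1) * R + algebraMap ℝ (H →L[ℂ] H) t) * R‖ ≤ t ^ 2 := by
  have hsa : IsSelfAdjoint R := .of_nonneg hR
  have hcfc : ((heatSemigroup R t - 1) * R + algebraMap ℝ (H →L[ℂ] H) t) * R =
      cfc (fun r => ((heatSymbol t r - 1) * r + t) * r) R := by
    rw [cfc_mul _ _ R, cfc_add R _ _, cfc_mul _ _ R, cfc_sub _ _ R, cfc_const_one ℝ R, cfc_id' ℝ R,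
      cfc_const _ R, heatSemigroup]
  rw [hcfc]
  exact norm_cfc_le (by positivity)
    fun r hr => abs_heatSymbol_sub_one_mul_add_mul_le t (spectrum_nonneg_of_nonneg hR hr)

theorem heatSemigroup_zero (hR : 0 ≤ R) : heatSemigroup R 0 = 1 := by
  have hsa : IsSelfAdjoint R := .of_nonneg hR
  rw [heatSemigroup, funext heatSymbol_zero, cfc_const_one ℝ R]

theorem isC0Semigroup_heatSemigroup (hR : 0 ≤ R) (hinj : Function.Injective R) :
    IsC0Semigroup (heatSemigroup R) where
  zero := heatSemigroup_zero hR
  add t t' := by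
    change cfc _ R = cfc _ R * cfc _ R
    rw [funext (heatSymbol_add t t'), cfc_mul _ _ R]
  continuous w := by
    have hdense := denseRange_of_isSelfAdjoint (.of_nonneg hR) hinj
    refine continuous_iff_continuousAt.2 fun t =>
      tendsto_apply_of_denseRange norm_heatSemigroup_le_one hdense (fun x => ?_) w
    rw [tendsto_iff_norm_sub_tendsto_zero]
    refine squeeze_zero (g := fun t' : ℝ≥0 => |(t' : ℝ) - t| * ‖x‖) (fun _ => norm_nonneg _)
      (fun t' => ?_) ?_
    · exact ContinuousLinearMap.le_of_opNorm_le ((heatSemigroup R t' - heatSemigroup R t) * R)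
        (norm_heatSemigroup_sub_mul_le hR t' t) x
    · exact (by fun_prop : Continuous fun t' : ℝ≥0 => |(t' : ℝ) - t| * ‖x‖).tendsto' _ _ (by simp)

theorem generatorGraph_heatSemigroup_apply (hR : 0 ≤ R) (hinj : Function.Injective R) (x : H) :
    GeneratorGraph (heatSemigroup R) (R x) (-x) := by
  let A : ℝ≥0 → H →L[ℂ] H := fun t => (t : ℝ)⁻¹ • ((heatSemigroup R t - 1) * R)
  have hA : ∀ t, ‖A t‖ ≤ 1 := fun t => by
    have hnorm := norm_heatSemigroup_sub_mul_le hR t 0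
    rw [heatSemigroup_zero hR, NNReal.coe_zero, sub_zero, NNReal.abs_eq] at hnorm
    rw [norm_smul, norm_inv, NNReal.norm_eq]
    exact (mul_le_mul_of_nonneg_left hnorm (by positivity)).trans inv_mul_le_one
  have hlim := tendsto_apply_of_denseRange (l := 𝓝[>] 0) (A := A) (B := -1) hA
    (denseRange_of_isSelfAdjoint (.of_nonneg hR) hinj) (fun y => ?_) x
  · simpa [A, GeneratorGraph, ← Complex.ofReal_inv] using hlim
  rw [tendsto_iff_norm_sub_tendsto_zero]
  refine squeeze_zero' (g := fun t : ℝ≥0 => (t : ℝ) * ‖y‖) (.of_forall fun _ => norm_nonneg _) ?_ ?_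
  · filter_upwards [self_mem_nhdsWithin] with t ht
    have ht0 : (t : ℝ) ≠ 0 := (NNReal.coe_pos.2 ht).ne'
    have hrem : A t (R y) - (-1 : H →L[ℂ] H) (R y) = (t : ℝ)⁻¹ •
        (((heatSemigroup R t - 1) * R + algebraMap ℝ (H →L[ℂ] H) t) * R) y := by
      simp [A, Algebra.algebraMap_eq_smul_one, smul_smul, ht0]
    rw [hrem, norm_smul, norm_inv, NNReal.norm_eq, inv_mul_le_iff₀ (by positivity), ← mul_assoc,
      ← sq]
    exact ContinuousLinearMap.le_of_opNorm_le _ (norm_heatSemigroup_sub_one_mul_add_mul_le hR t) y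
  · exact ((by fun_prop : Continuous fun t : ℝ≥0 => (t : ℝ) * ‖y‖).tendsto' _ _
      (by simp)).mono_left nhdsWithin_le_nhds

theorem generatorGraph_heatSemigroup_iff (hR : 0 ≤ R) (hinj : Function.Injective R) {w g : H} :
    GeneratorGraph (heatSemigroup R) w g ↔ w = R (-g) := by
  refine ⟨fun h => ?_, fun h => by
    simpa [h] using generatorGraph_heatSemigroup_apply hR hinj (-g)⟩
  have := tendsto_nhds_unique (h.map_of_commute (A := R) (commute_heatSemigroup hR))
    (generatorGraph_heatSemigroup_apply hR hinj w)
  rw [map_neg, this, neg_neg]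

theorem generatorGraph_exp_smul_heatSemigroup_iff (hR : 0 ≤ R) (hinj : Function.Injective R)
    (κ : ℝ) {w g : H} :
    GeneratorGraph (fun t : ℝ≥0 => Real.exp (κ * t) • heatSemigroup R t) w g ↔
      w = R (κ • w - g) := by
  rw [generatorGraph_exp_smul_iff (heatSemigroup_zero hR), generatorGraph_heatSemigroup_iff hR hinj,
    neg_sub]

theorem IsC0Semigroup.eq_exp_smul_heatSemigroup (hR : 0 ≤ R) (hinj : Function.Injective R) {κ : ℝ}
    {T : ℝ≥0 → H →L[ℂ] H} (hT : IsC0Semigroup T)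
    (hgen : ∀ w g, GeneratorGraph T w g ↔ w = R (κ • w - g)) (t : ℝ≥0) :
    T t = Real.exp (κ * t) • heatSemigroup R t := by
  have hT' : (fun t : ℝ≥0 => Real.exp (-κ * t) • T t) = heatSemigroup R :=
    (hT.exp_smul (-κ)).eq_of_generatorGraph (isC0Semigroup_heatSemigroup hR hinj)
      ((ContinuousLinearMap.nonneg_iff_isPositive R).1 hR) hinj
      (fun w g => by
        rw [generatorGraph_exp_smul_iff hT.zero, hgen]
        congr! 2
        module)
      (fun w g => generatorGraph_heatSemigroup_iff hR hinj)
  rw [← hT', smul_smul, ← Real.exp_add]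
  simp

end HeatSemigroup

/-! ### Resolvents of perturbed operators -/

section PerturbedResolvent

variable {H : Type*} [NormedAddCommGroup H] [InnerProductSpace ℂ H] {N V : H →L[ℂ] H}

/-- The operator `(N⁻² - V)⁻¹`, written as `N (1 - N V N)⁻¹ N` so that it makes sense when `N` is
not invertible. The value is junk unless `1 - N V N` is a unit. -/
def perturbedResolvent (N V : H →L[ℂ] H) : H →L[ℂ] H :=
  N * (1 - N * V * N)⁻¹ʳ * N

theorem eq_perturbedResolvent_iff (hG : IsUnit (1 - N * V * N)) {w g : H} :
    w = perturbedResolvent N V g ↔ w = N (N (g + V w)) := by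
  let G := 1 - N * V * N
  have hG_apply : ∀ v, G v = v - N (V (N v)) := fun v => rfl
  have hleft : ∀ v, G⁻¹ʳ (G v) = v := DFunLike.congr_fun (Ring.inverse_mul_cancel G hG)
  have hright : ∀ v, G (G⁻¹ʳ v) = v := DFunLike.congr_fun (Ring.mul_inverse_cancel G hG)
  constructor
  · rintro rfl
    change N (G⁻¹ʳ (N g)) = N (N (g + V (N (G⁻¹ʳ (N g)))))
    rw [map_add, ← sub_eq_iff_eq_add.1 ((hG_apply _).symm.trans (hright (N g)))]
  · intro hw
    have hNg : G (N (g + V w)) = N g := by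
      rw [hG_apply, ← hw, map_add, add_sub_cancel_right]
    calc w = N (N (g + V w)) := hw
      _ = N (G⁻¹ʳ (G (N (g + V w)))) := by rw [hleft]
      _ = perturbedResolvent N V g := by rw [hNg]; rfl

theorem injective_perturbedResolvent (hG : IsUnit (1 - N * V * N))
    (hinj : Function.Injective N) : Function.Injective (perturbedResolvent N V) := by
  rw [injective_iff_map_eq_zero]
  intro g hg
  have hNN : N (N (g + V 0)) = 0 := ((eq_perturbedResolvent_iff hG).1 hg.symm).symm
  rw [map_zero, add_zero] at hNN
  exact (injective_iff_map_eq_zero N).1 hinj _ ((injective_iff_map_eq_zero N).1 hinj _ hNN)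

theorem isCompactOperator_perturbedResolvent (hN : IsCompactOperator N) :
    IsCompactOperator (perturbedResolvent N V) :=
  hN.clm_comp (N * (1 - N * V * N)⁻¹ʳ)

variable [CompleteSpace H]

theorem isStrictlyPositive_one_sub_mul_mul (hN : IsSelfAdjoint N) (hV : IsSelfAdjoint V)
    {κ : ℝ} (hNκ : ‖N‖ ^ 2 ≤ κ⁻¹) (hVκ : ‖V‖ < κ) : IsStrictlyPositive (1 - N * V * N) := by
  have hκ : 0 < κ := (norm_nonneg V).trans_lt hVκ
  have hnorm : ‖N * V * N‖ < 1 :=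
    calc ‖N * V * N‖ ≤ ‖N‖ * ‖V‖ * ‖N‖ := norm_mul₃_le
      _ = ‖V‖ * ‖N‖ ^ 2 := by ring
      _ ≤ ‖V‖ * κ⁻¹ := by gcongr
      _ < κ * κ⁻¹ := by gcongr
      _ = 1 := mul_inv_cancel₀ hκ.ne'
  have hsa : IsSelfAdjoint (N * V * N) := by
    simpa only [hN.star_eq] using hV.conjugate N
  have hle : N * V * N ≤ 1 :=
    calc N * V * N ≤ algebraMap ℝ (H →L[ℂ] H) ‖N * V * N‖ := hsa.le_algebraMap_norm_self
      _ ≤ algebraMap ℝ (H →L[ℂ] H) 1 := algebraMap_mono _ hnorm.le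
      _ = 1 := map_one _
  exact ⟨sub_nonneg.2 hle, isUnit_one_sub_of_norm_lt_one hnorm⟩

/-- Factoring `1 - N V N = S S` exhibits the perturbed resolvent as `X X⋆` with `X = N S⁻¹`. -/
theorem exists_perturbedResolvent_eq_mul_star (hN : IsSelfAdjoint N)
    (hG : IsStrictlyPositive (1 - N * V * N)) :
    ∃ S : (H →L[ℂ] H)ˣ, (∀ v, ‖S.1 v‖ ^ 2 = ‖v‖ ^ 2 - (inner ℂ (N v) (V (N v))).re) ∧
      perturbedResolvent N V = (N * ↑S⁻¹) * star (N * ↑S⁻¹) := by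
  obtain ⟨S, hS⟩ := CFC.isUnit_sqrt_iff_isStrictlyPositive.2 hG
  have hSS : (S * S : H →L[ℂ] H) = 1 - N * V * N := by
    rw [hS, CFC.sqrt_mul_sqrt_self _ hG.nonneg]
  have hSsa : IsSelfAdjoint (S : H →L[ℂ] H) := by
    rw [hS]; exact .of_nonneg (CFC.sqrt_nonneg _)
  have hSinv : star (↑S⁻¹ : H →L[ℂ] H) = ↑S⁻¹ := by
    rw [← Ring.inverse_unit, ← Ring.inverse_star, hSsa.star_eq]
  refine ⟨S, fun v => ?_, ?_⟩
  · calc ‖S.1 v‖ ^ 2 = (inner ℂ (S.1 v) (S.1 v)).re := (inner_self_eq_norm_sq (𝕜 := ℂ) _).symm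
      _ = (inner ℂ v ((S * S : H →L[ℂ] H) v)).re :=
        congrArg Complex.re (hSsa.isSymmetric v (S.1 v))
      _ = (inner ℂ v (v - N (V (N v)))).re := by rw [hSS]; rfl
      _ = ‖v‖ ^ 2 - (inner ℂ (N v) (V (N v))).re := by
        rw [inner_sub_right, Complex.sub_re, ← inner_self_eq_norm_sq (𝕜 := ℂ) v,
          show inner ℂ v (N (V (N v))) = inner ℂ (N v) (V (N v)) from
            (hN.isSymmetric v (V (N v))).symm]
        rfl
  · rw [perturbedResolvent, ← hSS, ← Units.val_mul, Ring.inverse_unit, mul_inv_rev, Units.val_mul,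
      star_mul, hSinv, hN.star_eq]
    simp only [mul_assoc]

theorem perturbedResolvent_nonneg (hN : IsSelfAdjoint N)
    (hG : IsStrictlyPositive (1 - N * V * N)) : 0 ≤ perturbedResolvent N V := by
  obtain ⟨S, -, hR⟩ := exists_perturbedResolvent_eq_mul_star hN hG
  exact hR ▸ mul_star_self_nonneg _

/-- The norm bound says that `λ ≤ κ - 1 / ρ` on the spectrum of `κ - N⁻² + V`, and the form
inequality says the same about its quadratic form. -/
theorem norm_perturbedResolvent_le_iff (hN : IsSelfAdjoint N)
    (hG : IsStrictlyPositive (1 - N * V * N)) {ρ : ℝ} (hρ : 0 < ρ) :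
    ‖perturbedResolvent N V‖ ≤ ρ ↔
      ∀ v, ρ⁻¹ * ‖N v‖ ^ 2 ≤ ‖v‖ ^ 2 - (inner ℂ (N v) (V (N v))).re := by
  obtain ⟨S, hS, hR⟩ := exists_perturbedResolvent_eq_mul_star hN hG
  have hSS : ∀ v, (↑S⁻¹ : H →L[ℂ] H) (S.1 v) = v := DFunLike.congr_fun S.inv_mul
  have hSS' : ∀ v, S.1 ((↑S⁻¹ : H →L[ℂ] H) v) = v := DFunLike.congr_fun S.mul_inv
  have hnorm : ‖perturbedResolvent N V‖ ≤ ρ ↔ ‖N * ↑S⁻¹‖ ≤ √ρ := by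
    rw [hR, CStarRing.norm_self_mul_star, ← sq, Real.le_sqrt (norm_nonneg _) hρ.le]
  have hsq : ∀ v, ρ⁻¹ * ‖N v‖ ^ 2 ≤ ‖S.1 v‖ ^ 2 ↔ ‖N v‖ ≤ √ρ * ‖S.1 v‖ := fun v => by
    rw [inv_mul_le_iff₀ hρ, ← Real.sqrt_le_sqrt_iff (by positivity),
      Real.sqrt_mul hρ.le, Real.sqrt_sq (norm_nonneg _), Real.sqrt_sq (norm_nonneg _)]
  simp only [hnorm, ← hS, hsq]
  refine ⟨fun h v => ?_, fun h => ContinuousLinearMap.opNorm_le_bound _ (Real.sqrt_nonneg ρ)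
    fun v => ?_⟩
  · simpa [hSS] using ContinuousLinearMap.le_of_opNorm_le _ h (S.1 v)
  · simpa [hSS'] using h ((↑S⁻¹ : H →L[ℂ] H) v)

/-- With `X` as in `exists_perturbedResolvent_eq_mul_star`, the functional calculi of `X X⋆` and
`X⋆ X` are intertwined by `X`, so the semigroup preserves the range of `N`, with the same decay
rate in the norm transported from the space by `N`. -/
theorem exists_heatSemigroup_mul_eq (hN : IsSelfAdjoint N)
    (hG : IsStrictlyPositive (1 - N * V * N)) {ρ : ℝ} (hρ : ‖perturbedResolvent N V‖ ≤ ρ) :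
    ∃ C : ℝ, ∀ t : ℝ≥0, ∃ B : H →L[ℂ] H,
      heatSemigroup (perturbedResolvent N V) t * N = N * B ∧
        ‖B‖ ≤ C * Real.exp (-(t / ρ)) := by
  obtain ⟨S, -, hR⟩ := exists_perturbedResolvent_eq_mul_star hN hG
  set X := N * ↑S⁻¹
  have hNX : N = X * S := by rw [mul_assoc, Units.inv_mul, mul_one]
  have hρ' : ‖star X * X‖ ≤ ρ := by
    rwa [CStarRing.norm_star_mul_self, ← CStarRing.norm_self_mul_star, ← hR]
  refine ⟨‖(↑S⁻¹ : H →L[ℂ] H)‖ * ‖(S : H →L[ℂ] H)‖, fun t =>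
    ⟨↑S⁻¹ * heatSemigroup (star X * X) t * S, ?_, ?_⟩⟩
  · have hX : SemiconjBy X (heatSemigroup (star X * X) t) (heatSemigroup (X * star X) t) :=
      semiconjBy_cfc (.star_mul_self X) (.mul_star_self X) (mul_assoc X (star X) X).symm
        (continuous_heatSymbol t)
    calc heatSemigroup (perturbedResolvent N V) t * N
        = heatSemigroup (X * star X) t * X * S := by
          rw [hR, mul_assoc (heatSemigroup _ t), ← hNX]
      _ = N * (↑S⁻¹ * heatSemigroup (star X * X) t * S) := by
        rw [← hX.eq]; simp only [X, mul_assoc]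
  · refine norm_mul₃_le.trans ?_
    rw [mul_right_comm]
    gcongr
    exact norm_heatSemigroup_le hρ' t

theorem exists_eigenvector_norm {R : H →L[ℂ] H} (hR : 0 ≤ R) (hc : IsCompactOperator R)
    (hne : R ≠ 0) : ∃ w, w ≠ 0 ∧ R w = (‖R‖ : ℂ) • w := by
  have : Nontrivial (H →L[ℂ] H) := ⟨⟨R, 0, hne⟩⟩
  have hspec : (‖R‖ : ℂ) ∈ spectrum ℂ R :=
    spectrum.algebraMap_mem ℂ (CStarAlgebra.norm_mem_spectrum_of_nonneg hR)
  obtain ⟨w, hw⟩ :=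
    ((hc.hasEigenvalue_iff_mem_spectrum (by simpa using hne)).2 hspec).exists_hasEigenvector
  exact ⟨w, hw.2, hw.apply_eq_smul⟩

end PerturbedResolvent

/-! ### Fourier multipliers and Sobolev spaces on the plane -/

section MulOp

variable {α : Type*} [TopologicalSpace α] [MeasurableSpace α] [OpensMeasurableSpace α]
  {μ : Measure α}

theorem memLp_top_boundedContinuousFunction (μ : Measure α) (f : α →ᵇ ℂ) : MemLp f ∞ μ :=
  memLp_top_of_bound f.continuous.aestronglyMeasurable ‖f‖ (ae_of_all μ f.norm_coe_le_norm)

/-- A bounded continuous function as an element of `L^∞(μ)`. -/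
def toLpTop (μ : Measure α) : (α →ᵇ ℂ) →L[ℂ] Lp ℂ ∞ μ :=
  LinearMap.mkContinuous
    { toFun := fun f => (memLp_top_boundedContinuousFunction μ f).toLp f
      map_add' := fun _ _ => MemLp.toLp_add _ _
      map_smul' := fun _ _ => MemLp.toLp_const_smul _ _ }
    1 fun f => by
      rw [one_mul, LinearMap.coe_mk, AddHom.coe_mk, Lp.norm_toLp, eLpNorm_exponent_top]
      exact ENNReal.toReal_le_of_le_ofReal (norm_nonneg f)
        (eLpNormEssSup_le_of_ae_bound (ae_of_all μ f.norm_coe_le_norm))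

/-- Multiplication by a bounded continuous function on `L²(μ)`. -/
def mulOp (μ : Measure α) : (α →ᵇ ℂ) →L[ℂ] Lp ℂ 2 μ →L[ℂ] Lp ℂ 2 μ :=
  ((ContinuousLinearMap.mul ℂ ℂ).holderL μ ∞ 2 2).comp (toLpTop μ)

theorem coeFn_mulOp (f : α →ᵇ ℂ) (w : Lp ℂ 2 μ) : mulOp μ f w =ᵐ[μ] fun x => f x * w x := by
  refine ((ContinuousLinearMap.mul ℂ ℂ).coeFn_holder (p := ∞) (q := 2) (r := 2)
    (toLpTop μ f) w).trans ?_
  filter_upwards [(memLp_top_boundedContinuousFunction μ f).coeFn_toLp] with x hx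
  exact congrArg (· * w x) hx

theorem norm_mulOp_le (f : α →ᵇ ℂ) : ‖mulOp μ f‖ ≤ ‖f‖ := by
  refine ContinuousLinearMap.opNorm_le_bound _ (norm_nonneg f) fun w =>
    Lp.norm_le_mul_norm_of_ae_le_mul ?_
  filter_upwards [coeFn_mulOp f w] with x hx
  rw [hx, norm_mul]
  gcongr
  exact f.norm_coe_le_norm x

theorem isSelfAdjoint_mulOp {f : α →ᵇ ℂ} (hf : ∀ x, conj (f x) = f x) :
    IsSelfAdjoint (mulOp μ f) := by
  rw [ContinuousLinearMap.isSelfAdjoint_iff_isSymmetric]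
  intro w w'
  rw [ContinuousLinearMap.coe_coe, L2.inner_def, L2.inner_def]
  refine integral_congr_ae ?_
  filter_upwards [coeFn_mulOp f w, coeFn_mulOp f w'] with x hw hw'
  simp only [hw, hw', RCLike.inner_apply, map_mul, hf]
  ring

end MulOp

section FourierMultiplier

/-- The Fourier multiplier on `L²(ℝ²)` with a bounded continuous symbol. -/
def fourierMul (f : Plane →ᵇ ℂ) : L2Plane →L[ℂ] L2Plane :=
  (Lp.fourierTransformₗᵢ Plane ℂ).symm.conjStarAlgEquiv (mulOp volume f)

theorem norm_fourierMul_le (f : Plane →ᵇ ℂ) : ‖fourierMul f‖ ≤ ‖f‖ :=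
  (NonUnitalStarAlgHom.norm_apply_le _ _).trans (norm_mulOp_le f)

theorem isSelfAdjoint_fourierMul {f : Plane →ᵇ ℂ} (hf : ∀ ξ, conj (f ξ) = f ξ) :
    IsSelfAdjoint (fourierMul f) :=
  (isSelfAdjoint_mulOp hf).map _

theorem eq_fourierMul_iff {f : Plane →ᵇ ℂ} {v w : L2Plane} :
    w = fourierMul f v ↔
      (𝓕 w : L2Plane) =ᵐ[volume] fun ξ => f ξ * (𝓕 v : L2Plane) ξ := by
  have heq : w = fourierMul f v ↔ 𝓕 w = mulOp volume f (𝓕 v) :=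
    (Lp.fourierTransformₗᵢ Plane ℂ).toEquiv.eq_symm_apply
  rw [heq, Lp.ext_iff]
  exact ⟨fun h => h.trans (coeFn_mulOp f _), fun h => h.trans (coeFn_mulOp f _).symm⟩

theorem injective_fourierMul {f : Plane →ᵇ ℂ} (hf : ∀ ξ, f ξ ≠ 0) :
    Function.Injective (fourierMul f) := by
  intro v v' h
  refine (Lp.fourierTransformₗᵢ Plane ℂ).injective (Lp.ext ?_)
  filter_upwards [eq_fourierMul_iff.1 (rfl : fourierMul f v = _),
    eq_fourierMul_iff.1 h] with ξ hv hv'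
  exact mul_left_cancel₀ (hf ξ) (hv.symm.trans hv')

theorem injective_toTemperedDistribution :
    Function.Injective fun w : L2Plane => (w : 𝓢'(Plane, ℂ)) :=
  LinearMap.ker_eq_bot.1 (Lp.ker_toTemperedDistributionCLM_eq_bot (F := ℂ)
    (μ := (volume : Measure Plane)) (p := 2))

theorem toTemperedDistribution_eq_smulLeftCLM {p : Plane → ℂ} (hp : p.HasTemperateGrowth)
    {w g : L2Plane} (h : g =ᵐ[volume] fun ξ => p ξ * w ξ) :
    (g : 𝓢'(Plane, ℂ)) = TemperedDistribution.smulLeftCLM ℂ p (w : 𝓢'(Plane, ℂ)) := by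
  ext φ
  simp only [Lp.toTemperedDistribution_apply, TemperedDistribution.smulLeftCLM_apply_apply]
  refine integral_congr_ae ?_
  filter_upwards [h] with ξ hξ
  rw [hξ, SchwartzMap.smulLeftCLM_apply_apply hp]
  simp only [smul_eq_mul]
  ring

theorem toTemperedDistribution_eq_fourierMultiplierCLM {p : Plane → ℂ}
    (hp : p.HasTemperateGrowth) {w g : L2Plane}
    (h : (𝓕 g : L2Plane) =ᵐ[volume] fun ξ => p ξ * (𝓕 w : L2Plane) ξ) :
    (g : 𝓢'(Plane, ℂ)) =
      TemperedDistribution.fourierMultiplierCLM ℂ p (w : 𝓢'(Plane, ℂ)) := by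
  rw [TemperedDistribution.fourierMultiplierCLM_apply, Lp.fourier_toTemperedDistribution_eq,
    ← toTemperedDistribution_eq_smulLeftCLM hp h, Lp.fourierInv_toTemperedDistribution_eq,
    FourierTransform.fourierInv_fourier_eq]

theorem fourierMul_mul_apply (f f' : Plane →ᵇ ℂ) (w : L2Plane) :
    fourierMul (f * f') w = fourierMul f (fourierMul f' w) := by
  refine (eq_fourierMul_iff.2 ?_).symm
  filter_upwards [eq_fourierMul_iff.1 (rfl : fourierMul f (fourierMul f' w) = _),
    eq_fourierMul_iff.1 (rfl : fourierMul f' w = _)] with ξ h h'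
  rw [h, h', BoundedContinuousFunction.mul_apply, mul_assoc]

theorem exists_fourierMul_eq_of_norm_le {f f' : Plane →ᵇ ℂ} (hf' : ∀ ξ, f' ξ ≠ 0) {C : ℝ}
    (hC : ∀ ξ, ‖f ξ‖ ≤ C * ‖f' ξ‖) (v : L2Plane) :
    ∃ g, fourierMul f v = fourierMul f' g ∧ ‖g‖ ≤ C * ‖v‖ := by
  let r : Plane → ℂ := fun ξ => f ξ / f' ξ
  have hr : ∀ ξ, ‖r ξ‖ ≤ C := fun ξ => by
    rw [norm_div, div_le_iff₀ (norm_pos_iff.2 (hf' ξ))]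
    exact hC ξ
  have hmem : MemLp (fun ξ => r ξ * (𝓕 v : L2Plane) ξ) 2 volume :=
    (Lp.memLp (𝓕 v : L2Plane)).of_le_mul (c := C)
      ((f.continuous.div f'.continuous hf').aestronglyMeasurable.mul
        (Lp.aestronglyMeasurable _))
      (ae_of_all _ fun ξ => by rw [norm_mul]; gcongr; exact hr ξ)
  have hg : (𝓕 (𝓕⁻ (hmem.toLp _) : L2Plane) : L2Plane) =ᵐ[volume]
      fun ξ => r ξ * (𝓕 v : L2Plane) ξ := by
    rw [FourierTransform.fourier_fourierInv_eq]
    exact hmem.coeFn_toLp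
  refine ⟨𝓕⁻ (hmem.toLp _), eq_fourierMul_iff.2 ?_, ?_⟩
  · filter_upwards [hg, eq_fourierMul_iff.1 (rfl : fourierMul f v = _)] with ξ hξ hv
    rw [hv, hξ, ← mul_assoc, mul_div_cancel₀ _ (hf' ξ)]
  · rw [← (Lp.fourierTransformₗᵢ Plane ℂ).norm_map (𝓕⁻ (hmem.toLp _)),
      ← (Lp.fourierTransformₗᵢ Plane ℂ).norm_map v]
    refine Lp.norm_le_mul_norm_of_ae_le_mul ?_
    filter_upwards [hg] with ξ hξ
    refine (congrArg norm hξ).trans_le ?_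
    rw [norm_mul]
    exact mul_le_mul_of_nonneg_right (hr ξ) (norm_nonneg _)

theorem exists_fourierMul_fourierMul_eq_of_norm_le {f f' : Plane →ᵇ ℂ} (hf' : ∀ ξ, f' ξ ≠ 0)
    {C : ℝ} (hC : ∀ ξ, ‖f ξ‖ ≤ C * ‖f' ξ‖) (v : L2Plane) :
    ∃ g, fourierMul f (fourierMul f v) = fourierMul f' (fourierMul f' g) := by
  have hC2 : ∀ ξ, ‖(f * f) ξ‖ ≤ C * C * ‖(f' * f') ξ‖ := fun ξ => by
    rw [BoundedContinuousFunction.mul_apply, BoundedContinuousFunction.mul_apply, norm_mul,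
      norm_mul, mul_mul_mul_comm]
    exact mul_self_le_mul_self (norm_nonneg _) (hC ξ)
  obtain ⟨g, hg, -⟩ := exists_fourierMul_eq_of_norm_le
    (fun ξ => mul_ne_zero (hf' ξ) (hf' ξ)) hC2 v
  exact ⟨g, by rw [← fourierMul_mul_apply, ← fourierMul_mul_apply, hg]⟩

end FourierMultiplier

section Sobolev

open TemperedDistribution (besselPotential)

variable {p : ℝ}

/-- The symbol `(1 + |ξ|²)^(-p/2)` of the Bessel potential of order `-p ≤ 0`. -/
def besselSymbol (hp : 0 ≤ p) : Plane →ᵇ ℂ :=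
  BoundedContinuousFunction.ofNormedAddCommGroup
    (fun ξ => (((1 + ‖ξ‖ ^ 2) ^ (-p / 2) : ℝ) : ℂ))
    (Complex.continuous_ofReal.comp <|
      Continuous.rpow_const (by fun_prop) fun ξ => Or.inl (by positivity))
    1 fun ξ => by
      rw [Complex.norm_real, Real.norm_of_nonneg (by positivity)]
      exact Real.rpow_le_one_of_one_le_of_nonpos (le_add_of_nonneg_right (sq_nonneg _))
        (by linarith)

theorem besselSymbol_apply (hp : 0 ≤ p) (ξ : Plane) :
    besselSymbol hp ξ = (((1 + ‖ξ‖ ^ 2) ^ (-p / 2) : ℝ) : ℂ) :=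
  rfl

theorem besselSymbol_ne_zero (hp : 0 ≤ p) (ξ : Plane) : besselSymbol hp ξ ≠ 0 := by
  rw [besselSymbol_apply, Complex.ofReal_ne_zero]
  positivity

theorem besselPotential_eq_iff (hp : 0 ≤ p) {w g : L2Plane} :
    besselPotential Plane ℂ p (w : 𝓢'(Plane, ℂ)) = (g : 𝓢'(Plane, ℂ)) ↔
      w = fourierMul (besselSymbol hp) g := by
  have hneg : ((fourierMul (besselSymbol hp) g : L2Plane) : 𝓢'(Plane, ℂ)) =
      besselPotential Plane ℂ (-p) (g : 𝓢'(Plane, ℂ)) :=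
    toTemperedDistribution_eq_fourierMultiplierCLM (by fun_prop) (eq_fourierMul_iff.1 rfl)
  rw [← TemperedDistribution.besselPotential_neg_apply_eq_iff, ← hneg,
    injective_toTemperedDistribution.eq_iff, eq_comm]

theorem memH_iff (hp : 0 ≤ p) {w : L2Plane} :
    MemH p w ↔ ∃ g, w = fourierMul (besselSymbol hp) g :=
  exists_congr fun _ => besselPotential_eq_iff hp

theorem normH_fourierMul_besselSymbol (hp : 0 ≤ p) (g : L2Plane) :
    normH p (fourierMul (besselSymbol hp) g) = ‖g‖ := by
  have h : MemH p (fourierMul (besselSymbol hp) g) := (memH_iff hp).2 ⟨g, rfl⟩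
  rw [normH, dif_pos h, ← injective_fourierMul (besselSymbol_ne_zero hp)
    ((besselPotential_eq_iff hp).1 h.choose_spec)]

end Sobolev

section PlaneSymbol

open TemperedDistribution (fourierMultiplierCLM)

variable {ε ω : ℝ}

/-- The Fourier symbol of `1 + (1 + 2εω)∂ₓ² + ∂_y²`. -/
def planeSymbol (ε ω : ℝ) (ξ : Plane) : ℝ :=
  1 - (1 + 2 * ε * ω) * (2 * Real.pi * ξ 0) ^ 2 - (2 * Real.pi * ξ 1) ^ 2

theorem continuous_planeSymbol : Continuous (planeSymbol ε ω) := by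
  unfold planeSymbol
  fun_prop

theorem hasTemperateGrowth_coord (i : Fin 2) :
    Function.HasTemperateGrowth fun ξ : Plane => ξ i :=
  (EuclideanSpace.proj (𝕜 := ℝ) i : Plane →L[ℝ] ℝ).hasTemperateGrowth

theorem hasTemperateGrowth_planeSymbol :
    Function.HasTemperateGrowth fun ξ : Plane => (planeSymbol ε ω ξ : ℂ) := by
  have h0 := hasTemperateGrowth_coord 0
  have h1 := hasTemperateGrowth_coord 1
  unfold planeSymbol
  fun_prop

theorem lineDeriv_single_eq (i : Fin 2) (f : 𝓢'(Plane, ℂ)) :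
    ∂_{EuclideanSpace.single i (1 : ℝ)} f =
      fourierMultiplierCLM ℂ (fun ξ : Plane => 2 * Real.pi * Complex.I * (ξ i : ℂ)) f := by
  have hcoord : Function.HasTemperateGrowth fun ξ : Plane => (ξ i : ℂ) := by
    have := hasTemperateGrowth_coord i
    fun_prop
  have hinner : (fun ξ : Plane => ((inner ℝ ξ (EuclideanSpace.single i (1 : ℝ)) : ℝ) : ℂ)) =
      fun ξ : Plane => (ξ i : ℂ) := by
    ext ξ
    simp [EuclideanSpace.inner_single_right]
  rw [TemperedDistribution.lineDeriv_eq_fourierMultiplierCLM]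
  change _ • fourierMultiplierCLM ℂ
    (fun ξ : Plane => ((inner ℝ ξ (EuclideanSpace.single i (1 : ℝ)) : ℝ) : ℂ)) f = _
  rw [hinner, ← _root_.smul_apply, ← TemperedDistribution.fourierMultiplierCLM_smul hcoord]
  rfl

theorem fourierMultiplierCLM_add {g₁ g₂ : Plane → ℂ} (h₁ : g₁.HasTemperateGrowth)
    (h₂ : g₂.HasTemperateGrowth) (f : 𝓢'(Plane, ℂ)) :
    fourierMultiplierCLM ℂ (g₁ + g₂) f =
      fourierMultiplierCLM ℂ g₁ f + fourierMultiplierCLM ℂ g₂ f := by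
  simp only [TemperedDistribution.fourierMultiplierCLM_apply,
    TemperedDistribution.smulLeftCLM_add h₁ h₂, _root_.add_apply, FourierTransform.fourierInv_add]

theorem opA_eq_fourierMultiplierCLM (f : 𝓢'(Plane, ℂ)) :
    opA ε ω f = fourierMultiplierCLM ℂ (fun ξ => (planeSymbol ε ω ξ : ℂ)) f := by
  let D : Fin 2 → Plane → ℂ := fun i ξ => 2 * Real.pi * Complex.I * (ξ i : ℂ)
  have hD : ∀ i, (D i).HasTemperateGrowth := fun i => by
    have := hasTemperateGrowth_coord i
    fun_prop
  have hD2 : ∀ i, (D i * D i).HasTemperateGrowth := fun i => (hD i).mul (hD i)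
  have hone : Function.HasTemperateGrowth fun _ : Plane => (1 : ℂ) := by fun_prop
  have hk : (((1 + 2 * ε * ω : ℝ) : ℂ) • (D 0 * D 0)).HasTemperateGrowth :=
    (Function.HasTemperateGrowth.const _).mul (hD2 0)
  have hf : fourierMultiplierCLM ℂ (fun _ : Plane => (1 : ℂ)) f = f := by
    rw [TemperedDistribution.fourierMultiplierCLM_const, one_smul, ContinuousLinearMap.id_apply]
  have hsymbol : (fun ξ => (planeSymbol ε ω ξ : ℂ)) =
      (fun _ : Plane => (1 : ℂ)) + ((1 + 2 * ε * ω : ℝ) : ℂ) • (D 0 * D 0) + D 1 * D 1 := by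
    ext ξ
    simp only [planeSymbol, D, Pi.add_apply, Pi.smul_apply, Pi.mul_apply, smul_eq_mul]
    push_cast
    linear_combination (-(1 + 2 * ε * ω) * (2 * Real.pi * ξ 0) ^ 2 - (2 * Real.pi * ξ 1) ^ 2 : ℂ)
      * Complex.I_sq
  rw [hsymbol, fourierMultiplierCLM_add (hone.add hk) (hD2 1), fourierMultiplierCLM_add hone hk,
    TemperedDistribution.fourierMultiplierCLM_smul (hD2 0), hf,
    ← TemperedDistribution.fourierMultiplierCLM_fourierMultiplierCLM_apply (hD 1) (hD 1),
    _root_.smul_apply,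
    ← TemperedDistribution.fourierMultiplierCLM_fourierMultiplierCLM_apply (hD 0) (hD 0),
    ← lineDeriv_single_eq, ← lineDeriv_single_eq, ← lineDeriv_single_eq, ← lineDeriv_single_eq,
    opA]

theorem toTemperedDistribution_eq_opA_opA {w g : L2Plane}
    (h : (𝓕 g : L2Plane) =ᵐ[volume] fun ξ => (planeSymbol ε ω ξ : ℂ) ^ 2 * (𝓕 w : L2Plane) ξ) :
    (g : 𝓢'(Plane, ℂ)) = opA ε ω (opA ε ω (w : 𝓢'(Plane, ℂ))) := by
  have hp := hasTemperateGrowth_planeSymbol (ε := ε) (ω := ω)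
  rw [opA_eq_fourierMultiplierCLM, opA_eq_fourierMultiplierCLM,
    TemperedDistribution.fourierMultiplierCLM_fourierMultiplierCLM_apply hp hp]
  refine toTemperedDistribution_eq_fourierMultiplierCLM (hp.mul hp) ?_
  filter_upwards [h] with ξ hξ
  rw [hξ, Pi.mul_apply, sq]

theorem planeSymbol_eq (ξ : Plane) :
    planeSymbol ε ω ξ = 1 - (2 * Real.pi) ^ 2 * ((1 + 2 * ε * ω) * ξ 0 ^ 2 + ξ 1 ^ 2) := by
  rw [planeSymbol]
  ring

theorem exists_abs_planeSymbol_le (hk : 0 < 1 + 2 * ε * ω) :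
    ∃ C : ℝ, ∀ ξ : Plane, |planeSymbol ε ω ξ| ≤ C * (1 + ‖ξ‖ ^ 2) := by
  refine ⟨1 + (2 * Real.pi) ^ 2 * (1 + (1 + 2 * ε * ω)), fun ξ => ?_⟩
  rw [planeSymbol_eq, EuclideanSpace.real_norm_sq_eq, Fin.sum_univ_two]
  generalize 1 + 2 * ε * ω = k at hk
  have hP : 0 ≤ (2 * Real.pi) ^ 2 := by positivity
  generalize (2 * Real.pi) ^ 2 = P at hP
  refine (abs_sub _ _).trans ?_
  rw [abs_one, abs_of_nonneg (by positivity)]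
  have : 0 ≤ P * ξ 0 ^ 2 + P * k * ξ 1 ^ 2 + P * (1 + k) + (ξ 0 ^ 2 + ξ 1 ^ 2) := by positivity
  linear_combination this

theorem exists_one_add_norm_sq_le (hk : 0 < 1 + 2 * ε * ω) :
    ∃ C : ℝ, ∀ ξ : Plane, 1 + ‖ξ‖ ^ 2 ≤ C * (1 + |planeSymbol ε ω ξ|) := by
  let c := min (1 + 2 * ε * ω) 1 * (2 * Real.pi) ^ 2
  have hc : 0 < c := by positivity
  refine ⟨1 + c⁻¹, fun ξ => ?_⟩
  have hle : c * ‖ξ‖ ^ 2 ≤ 1 + |planeSymbol ε ω ξ| :=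
    calc c * ‖ξ‖ ^ 2
        = (2 * Real.pi) ^ 2 * (min (1 + 2 * ε * ω) 1 * ξ 0 ^ 2
            + min (1 + 2 * ε * ω) 1 * ξ 1 ^ 2) := by
          rw [EuclideanSpace.real_norm_sq_eq, Fin.sum_univ_two]
          ring
      _ ≤ (2 * Real.pi) ^ 2 * ((1 + 2 * ε * ω) * ξ 0 ^ 2 + 1 * ξ 1 ^ 2) := by
          gcongr
          · exact min_le_left _ _
          · exact min_le_right _ _
      _ = 1 - planeSymbol ε ω ξ := by
          rw [planeSymbol_eq]
          ring
      _ ≤ 1 + |planeSymbol ε ω ξ| := by linarith [neg_abs_le (planeSymbol ε ω ξ)]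
  have hξ : ‖ξ‖ ^ 2 ≤ c⁻¹ * (1 + |planeSymbol ε ω ξ|) := (le_inv_mul_iff₀ hc).2 hle
  linarith [abs_nonneg (planeSymbol ε ω ξ)]

end PlaneSymbol

section ResolventWeight

variable {κ : ℝ}

/-- The function `t ↦ (t² + κ)^(-1/2)`, for `κ > 0`. -/
def resolventWeight (hκ : 0 < κ) : ℝ →ᵇ ℂ :=
  BoundedContinuousFunction.ofNormedAddCommGroup (fun t => (((√(t ^ 2 + κ))⁻¹ : ℝ) : ℂ))
    (Complex.continuous_ofReal.comp <|
      Continuous.inv₀ (by fun_prop) fun t => (Real.sqrt_pos.2 (by positivity)).ne')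
    (√κ)⁻¹ fun t => by
      rw [Complex.norm_real, Real.norm_of_nonneg (by positivity)]
      gcongr
      exact le_add_of_nonneg_left (sq_nonneg t)

theorem resolventWeight_apply (hκ : 0 < κ) (t : ℝ) :
    resolventWeight hκ t = (((√(t ^ 2 + κ))⁻¹ : ℝ) : ℂ) :=
  rfl

theorem norm_resolventWeight_apply (hκ : 0 < κ) (t : ℝ) :
    ‖resolventWeight hκ t‖ = (√(t ^ 2 + κ))⁻¹ := by
  rw [resolventWeight_apply, Complex.norm_real, Real.norm_of_nonneg (by positivity)]

theorem conj_resolventWeight (hκ : 0 < κ) (t : ℝ) :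
    conj (resolventWeight hκ t) = resolventWeight hκ t :=
  Complex.conj_ofReal _

theorem norm_resolventWeight_le (hκ : 0 < κ) : ‖resolventWeight hκ‖ ≤ (√κ)⁻¹ :=
  BoundedContinuousFunction.norm_ofNormedAddCommGroup_le _ (by positivity) _

theorem resolventWeight_sq_mul (hκ : 0 < κ) (t : ℝ) :
    resolventWeight hκ t ^ 2 * ((t : ℂ) ^ 2 + κ) = 1 := by
  have h : 0 < t ^ 2 + κ := by positivity
  rw [resolventWeight_apply]
  norm_cast
  rw [inv_pow, Real.sq_sqrt h.le, inv_mul_cancel₀ h.ne']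

theorem resolventWeight_ne_zero (hκ : 0 < κ) (t : ℝ) : resolventWeight hκ t ≠ 0 := fun h => by
  simpa [h] using resolventWeight_sq_mul hκ t

theorem exists_one_add_abs_le_mul_sqrt (hκ : 0 < κ) :
    ∃ C, ∀ t : ℝ, 1 + |t| ≤ C * √(t ^ 2 + κ) := by
  have hsκ : 0 < √κ := Real.sqrt_pos.2 hκ
  refine ⟨(√κ)⁻¹ + 1, fun t => ?_⟩
  have h1 : 1 ≤ (√κ)⁻¹ * √(t ^ 2 + κ) :=
    (le_inv_mul_iff₀ hsκ).2 <| by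
      rw [mul_one]
      exact Real.sqrt_le_sqrt (le_add_of_nonneg_left (sq_nonneg t))
  have h2 : |t| ≤ √(t ^ 2 + κ) := Real.abs_le_sqrt (le_add_of_nonneg_right hκ.le)
  linarith

theorem sqrt_sq_add_le (hκ : 0 < κ) (t : ℝ) : √(t ^ 2 + κ) ≤ √κ + |t| := by
  refine Real.sqrt_le_iff.2 ⟨by positivity, ?_⟩
  have : 0 ≤ √κ * |t| := by positivity
  linear_combination 2 * this + (sq_abs t).ge + (Real.sq_sqrt hκ.le).ge

end ResolventWeight

section PlaneResolvent

variable {ε ω κ : ℝ}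

/-- The function `(a² + κ)^(-1/2)`, where `a` is the Fourier symbol of
`1 + (1 + 2εω)∂ₓ² + ∂_y²`. -/
def planeWeight (ε ω : ℝ) (hκ : 0 < κ) : Plane →ᵇ ℂ :=
  (resolventWeight hκ).compContinuous ⟨planeSymbol ε ω, continuous_planeSymbol⟩

theorem planeWeight_apply (hκ : 0 < κ) (ξ : Plane) :
    planeWeight ε ω hκ ξ = resolventWeight hκ (planeSymbol ε ω ξ) :=
  rfl

theorem planeWeight_ne_zero (hκ : 0 < κ) (ξ : Plane) : planeWeight ε ω hκ ξ ≠ 0 :=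
  resolventWeight_ne_zero hκ _

theorem exists_norm_planeWeight_le (hk : 0 < 1 + 2 * ε * ω) (hκ : 0 < κ) :
    ∃ C, ∀ ξ, ‖planeWeight ε ω hκ ξ‖ ≤ C * (1 + ‖ξ‖ ^ 2)⁻¹ := by
  obtain ⟨A, hA⟩ := exists_one_add_norm_sq_le hk
  obtain ⟨B, hB⟩ := exists_one_add_abs_le_mul_sqrt hκ
  have hA0 : 0 ≤ A := le_of_mul_le_mul_right
    (by rw [zero_mul]; exact (by positivity : (0 : ℝ) ≤ 1 + ‖(0 : Plane)‖ ^ 2).trans (hA 0))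
    (by positivity : 0 < 1 + |planeSymbol ε ω 0|)
  refine ⟨A * B, fun ξ => ?_⟩
  rw [planeWeight_apply, norm_resolventWeight_apply, ← div_eq_mul_inv,
    le_div_iff₀ (by positivity), inv_mul_le_iff₀ (Real.sqrt_pos.2 (by positivity))]
  calc 1 + ‖ξ‖ ^ 2 ≤ A * (1 + |planeSymbol ε ω ξ|) := hA ξ
    _ ≤ A * (B * √(planeSymbol ε ω ξ ^ 2 + κ)) := by gcongr; exact hB _
    _ = √(planeSymbol ε ω ξ ^ 2 + κ) * (A * B) := by ring

theorem exists_inv_le_norm_planeWeight (hk : 0 < 1 + 2 * ε * ω) (hκ : 0 < κ) :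
    ∃ C, ∀ ξ, (1 + ‖ξ‖ ^ 2)⁻¹ ≤ C * ‖planeWeight ε ω hκ ξ‖ := by
  obtain ⟨A, hA⟩ := exists_abs_planeSymbol_le hk
  refine ⟨√κ + A, fun ξ => ?_⟩
  have hξ : 1 ≤ 1 + ‖ξ‖ ^ 2 := le_add_of_nonneg_right (sq_nonneg _)
  rw [planeWeight_apply, norm_resolventWeight_apply, ← div_eq_mul_inv,
    le_div_iff₀ (Real.sqrt_pos.2 (by positivity)), inv_mul_le_iff₀ (by positivity)]
  calc √(planeSymbol ε ω ξ ^ 2 + κ)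
      ≤ √κ + |planeSymbol ε ω ξ| := sqrt_sq_add_le hκ _
    _ ≤ √κ * (1 + ‖ξ‖ ^ 2) + A * (1 + ‖ξ‖ ^ 2) :=
        add_le_add (le_mul_of_one_le_right (by positivity) hξ) (hA ξ)
    _ = (1 + ‖ξ‖ ^ 2) * (√κ + A) := by ring

/-- The operator `((1 + (1 + 2εω)∂ₓ² + ∂_y²)² + κ)^(-1/2)` on `L²(ℝ²)`. -/
def planeN (ε ω : ℝ) (hκ : 0 < κ) : L2Plane →L[ℂ] L2Plane :=
  fourierMul (planeWeight ε ω hκ)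

theorem isSelfAdjoint_planeN (hκ : 0 < κ) : IsSelfAdjoint (planeN ε ω hκ) :=
  isSelfAdjoint_fourierMul fun _ => conj_resolventWeight hκ _

theorem injective_planeN (hκ : 0 < κ) : Function.Injective (planeN ε ω hκ) :=
  injective_fourierMul (planeWeight_ne_zero hκ)

theorem norm_planeN_sq_le (hκ : 0 < κ) : ‖planeN ε ω hκ‖ ^ 2 ≤ κ⁻¹ := by
  have h : ‖planeN ε ω hκ‖ ≤ (√κ)⁻¹ :=
    calc ‖planeN ε ω hκ‖ ≤ ‖planeWeight ε ω hκ‖ := norm_fourierMul_le _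
      _ ≤ ‖resolventWeight hκ‖ :=
          (BoundedContinuousFunction.norm_le (norm_nonneg _)).2 fun _ =>
            (resolventWeight hκ).norm_coe_le_norm _
      _ ≤ (√κ)⁻¹ := norm_resolventWeight_le hκ
  calc ‖planeN ε ω hκ‖ ^ 2 ≤ (√κ)⁻¹ ^ 2 := by gcongr
    _ = κ⁻¹ := by rw [inv_pow, Real.sq_sqrt hκ.le]

theorem fourier_planeN (hκ : 0 < κ) (v : L2Plane) :
    (𝓕 (planeN ε ω hκ v) : L2Plane) =ᵐ[volume]
      fun ξ => planeWeight ε ω hκ ξ * (𝓕 v : L2Plane) ξ :=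
  eq_fourierMul_iff.1 rfl

theorem besselSymbol_two (ξ : Plane) :
    besselSymbol zero_le_two ξ = (((1 + ‖ξ‖ ^ 2)⁻¹ : ℝ) : ℂ) := by
  rw [besselSymbol_apply, ← Real.rpow_neg_one]
  norm_num

theorem besselSymbol_four :
    besselSymbol zero_le_four =
      besselSymbol zero_le_two * besselSymbol (zero_le_two (α := ℝ)) := by
  ext ξ
  rw [BoundedContinuousFunction.mul_apply, besselSymbol_apply, besselSymbol_apply,
    ← Complex.ofReal_mul, ← Real.rpow_add (by positivity)]
  norm_num

theorem norm_besselSymbol_two (ξ : Plane) :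
    ‖besselSymbol zero_le_two ξ‖ = (1 + ‖ξ‖ ^ 2)⁻¹ := by
  rw [besselSymbol_two, Complex.norm_real, Real.norm_of_nonneg (by positivity)]

theorem exists_normH_planeN_le (hk : 0 < 1 + 2 * ε * ω) (hκ : 0 < κ) :
    ∃ C, ∀ v, MemH 2 (planeN ε ω hκ v) ∧ normH 2 (planeN ε ω hκ v) ≤ C * ‖v‖ := by
  obtain ⟨C, hC⟩ := exists_norm_planeWeight_le hk hκ
  refine ⟨C, fun v => ?_⟩
  obtain ⟨g, hg, hgv⟩ := exists_fourierMul_eq_of_norm_le (besselSymbol_ne_zero zero_le_two)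
    (fun ξ => (hC ξ).trans_eq (by rw [norm_besselSymbol_two])) v
  rw [planeN, hg, normH_fourierMul_besselSymbol]
  exact ⟨(memH_iff zero_le_two).2 ⟨g, rfl⟩, hgv⟩

theorem exists_eq_planeN_of_memH_two (hk : 0 < 1 + 2 * ε * ω) (hκ : 0 < κ) :
    ∃ C, ∀ w, MemH 2 w → ∃ v, w = planeN ε ω hκ v ∧ ‖v‖ ≤ C * normH 2 w := by
  obtain ⟨C, hC⟩ := exists_inv_le_norm_planeWeight hk hκ
  refine ⟨C, fun w hw => ?_⟩
  obtain ⟨g, rfl⟩ := (memH_iff zero_le_two).1 hw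
  rw [normH_fourierMul_besselSymbol]
  exact exists_fourierMul_eq_of_norm_le (planeWeight_ne_zero hκ)
    (fun ξ => (norm_besselSymbol_two ξ).trans_le (hC ξ)) g

theorem memH_four_iff (hk : 0 < 1 + 2 * ε * ω) (hκ : 0 < κ) {w : L2Plane} :
    MemH 4 w ↔ ∃ v, w = planeN ε ω hκ (planeN ε ω hκ v) := by
  obtain ⟨A, hA⟩ := exists_norm_planeWeight_le hk hκ
  obtain ⟨B, hB⟩ := exists_inv_le_norm_planeWeight hk hκ
  simp only [memH_iff zero_le_four, besselSymbol_four, fourierMul_mul_apply, planeN]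
  constructor
  · rintro ⟨g, rfl⟩
    exact exists_fourierMul_fourierMul_eq_of_norm_le (planeWeight_ne_zero hκ)
      (fun ξ => (norm_besselSymbol_two ξ).trans_le (hB ξ)) g
  · rintro ⟨v, rfl⟩
    exact exists_fourierMul_fourierMul_eq_of_norm_le (besselSymbol_ne_zero zero_le_two)
      (fun ξ => (hA ξ).trans_eq (by rw [norm_besselSymbol_two])) v

theorem opA_opA_planeN_planeN (hκ : 0 < κ) (v : L2Plane) :
    opA ε ω (opA ε ω (planeN ε ω hκ (planeN ε ω hκ v) : 𝓢'(Plane, ℂ))) =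
      ((v - (κ : ℂ) • planeN ε ω hκ (planeN ε ω hκ v) : L2Plane) : 𝓢'(Plane, ℂ)) := by
  let w := planeN ε ω hκ (planeN ε ω hκ v)
  refine (toTemperedDistribution_eq_opA_opA ?_).symm
  have hsub : (𝓕 (v - (κ : ℂ) • w) : L2Plane) = 𝓕 v - (κ : ℂ) • 𝓕 w :=
    (map_sub (Lp.fourierTransformₗᵢ Plane ℂ) v _).trans
      (congrArg _ (map_smul (Lp.fourierTransformₗᵢ Plane ℂ) (κ : ℂ) w))
  rw [hsub]
  filter_upwards [Lp.coeFn_sub (𝓕 v : L2Plane) ((κ : ℂ) • 𝓕 w),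
    Lp.coeFn_smul (κ : ℂ) (𝓕 w : L2Plane), fourier_planeN hκ (planeN ε ω hκ v),
    fourier_planeN hκ v] with ξ hs hκw hw hv
  rw [hs, Pi.sub_apply, hκw, Pi.smul_apply, hw, hv, smul_eq_mul, planeWeight_apply]
  linear_combination (-(𝓕 v : L2Plane) ξ) * resolventWeight_sq_mul hκ (planeSymbol ε ω ξ)

variable {s b : ℝ} {u : ℝ → ℝ} {V : L2Plane →L[ℂ] L2Plane}

theorem linearizedGraph_iff_eq_neg_opA_opA
    (hV : ∀ w, V w =ᵐ[volume] fun z => (potential s b ε u (z 0) : ℂ) * w z) {w g : L2Plane} :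
    LinearizedGraph s b ε ω u w g ↔ MemH 4 w ∧
      (g : 𝓢'(Plane, ℂ)) = -opA ε ω (opA ε ω (w : 𝓢'(Plane, ℂ))) + (V w : 𝓢'(Plane, ℂ)) := by
  refine and_congr_right fun _ => ⟨?_, fun h => ⟨V w, hV w, h⟩⟩
  rintro ⟨q, hq, h⟩
  have hqV : q = V w := by
    refine Lp.ext ?_
    filter_upwards [hq, hV w] with z hz hz' using hz.trans hz'.symm
  rwa [← hqV]

theorem linearizedGraph_iff
    (hV : ∀ w, V w =ᵐ[volume] fun z => (potential s b ε u (z 0) : ℂ) * w z)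
    (hk : 0 < 1 + 2 * ε * ω) (hκ : 0 < κ) {w g : L2Plane} :
    LinearizedGraph s b ε ω u w g ↔
      w = planeN ε ω hκ (planeN ε ω hκ ((κ : ℂ) • w - g + V w)) := by
  have hgraph : ∀ {v}, w = planeN ε ω hκ (planeN ε ω hκ v) →
      ((g : 𝓢'(Plane, ℂ)) = -opA ε ω (opA ε ω (w : 𝓢'(Plane, ℂ))) + (V w : 𝓢'(Plane, ℂ)) ↔
        v = (κ : ℂ) • w - g + V w) := fun {v} hv => by
    have hlin : -opA ε ω (opA ε ω (w : 𝓢'(Plane, ℂ))) + (V w : 𝓢'(Plane, ℂ)) =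
        ((-(v - (κ : ℂ) • w) + V w : L2Plane) : 𝓢'(Plane, ℂ)) := by
      rw [hv, opA_opA_planeN_planeN, ← hv]
      exact ((map_add (Lp.toTemperedDistributionCLM ℂ volume 2) _ _).trans
        (congrArg (· + _) (map_neg (Lp.toTemperedDistributionCLM ℂ volume 2) _))).symm
    rw [hlin, injective_toTemperedDistribution.eq_iff]
    constructor <;> rintro h <;> rw [h] <;> abel
  rw [linearizedGraph_iff_eq_neg_opA_opA hV, memH_four_iff hk hκ]
  constructor
  · rintro ⟨⟨v, hv⟩, hg⟩
    exact (hgraph hv).1 hg ▸ hv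
  · exact fun hw => ⟨⟨_, hw⟩, (hgraph hw).2 rfl⟩

end PlaneResolvent

/-! ### Bloch operators -/

section HilbertBasis

variable {H ι : Type*} [NormedAddCommGroup H] [InnerProductSpace ℂ H] (e : HilbertBasis ι ℂ H)

theorem ext_inner_basis {x y : H} (h : ∀ i, inner ℂ (e i) x = inner ℂ (e i) y) : x = y := by
  apply e.repr.injective
  ext i
  rw [e.repr_apply_apply, e.repr_apply_apply, h]

theorem hasSum_norm_sq_inner (x : H) : HasSum (fun i => ‖inner ℂ (e i) x‖ ^ 2) (‖x‖ ^ 2) := by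
  convert (e.hasSum_inner_mul_inner x x).mapL Complex.reCLM using 1
  · funext i
    rw [← inner_conj_symm x (e i), Complex.conj_mul']
    norm_cast
  · exact (inner_self_eq_norm_sq (𝕜 := ℂ) x).symm

theorem exists_forall_inner_basis_eq {c : ι → ℂ} (hc : Summable fun i => ‖c i‖ ^ 2) :
    ∃ x : H, ∀ i, inner ℂ (e i) x = c i := by
  have hc2 : Memℓp c 2 := by
    rw [memℓp_gen_iff (by norm_num)]
    simpa only [ENNReal.toReal_ofNat, Real.rpow_ofNat] using hc
  refine ⟨e.repr.symm ⟨c, hc2⟩, fun i => ?_⟩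
  rw [← e.repr_apply_apply, LinearIsometryEquiv.apply_symm_apply]

theorem norm_sq_sum_smul_basis (S : Finset ι) (c : ι → ℂ) :
    ‖∑ i ∈ S, c i • e i‖ ^ 2 = ∑ i ∈ S, ‖c i‖ ^ 2 := by
  rw [← inner_self_eq_norm_sq (𝕜 := ℂ), e.orthonormal.inner_sum, map_sum]
  refine Finset.sum_congr rfl fun i _ => ?_
  rw [Complex.conj_mul']
  norm_cast

end HilbertBasis

theorem isCompactOperator_rankOne {H : Type*} [NormedAddCommGroup H] [InnerProductSpace ℂ H]
    (x y : H) : IsCompactOperator (InnerProductSpace.rankOne ℂ x y) := by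
  rw [InnerProductSpace.rankOne_def']
  exact (isCompactOperator_of_locallyCompactSpace_rng
    (ContinuousLinearMap.toSpanSingleton ℂ x)).comp_clm (innerSL ℂ y)

section DiagonalOperator

variable {H ι : Type*} [NormedAddCommGroup H] [InnerProductSpace ℂ H] [CompleteSpace H]
  (e : HilbertBasis ι ℂ H) {m : ι → ℂ}

/-- The operator with eigenvectors `e i` and eigenvalues `m i`. The value is junk unless `m` is
summable. -/
def diagOp (m : ι → ℂ) : H →L[ℂ] H :=
  ∑' i, m i • InnerProductSpace.rankOne ℂ (e i) (e i)

theorem hasSum_diagOp (hm : Summable m) :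
    HasSum (fun i => m i • InnerProductSpace.rankOne ℂ (e i) (e i)) (diagOp e m) := by
  refine (Summable.of_norm_bounded hm.norm fun i => ?_).hasSum
  rw [norm_smul, InnerProductSpace.norm_rankOne, e.orthonormal.1 i, one_mul, mul_one]

theorem inner_diagOp (hm : Summable m) (i : ι) (x : H) :
    inner ℂ (e i) (diagOp e m x) = m i * inner ℂ (e i) x := by
  classical
  have hsum := ((hasSum_diagOp e hm).mapL (ContinuousLinearMap.apply ℂ H x)).mapL
    (innerSL ℂ (e i))
  refine hsum.unique ?_
  convert hasSum_single i fun j hj => ?_ using 1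
  · simp [e.orthonormal.1 i]
  · simp [e.orthonormal.2 hj.symm]

theorem diagOp_basis (hm : Summable m) (i : ι) : diagOp e m (e i) = m i • e i := by
  classical
  refine ((hasSum_diagOp e hm).mapL (ContinuousLinearMap.apply ℂ H (e i))).unique ?_
  convert hasSum_single i fun j hj => ?_ using 1
  · simp [e.orthonormal.1 i]
  · simp [e.orthonormal.2 hj]

theorem isCompactOperator_diagOp (hm : Summable m) : IsCompactOperator (diagOp e m) :=
  isCompactOperator_of_tendsto (hasSum_diagOp e hm) <| Eventually.of_forall fun _ =>
    (compactOperator (RingHom.id ℂ) H H).sum_mem fun i _ =>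
      Submodule.smul_mem _ _ (isCompactOperator_rankOne (e i) (e i))

theorem norm_diagOp_le (hm : Summable m) {C : ℝ} (hC : 0 ≤ C) (h : ∀ i, ‖m i‖ ≤ C) :
    ‖diagOp e m‖ ≤ C := by
  refine ContinuousLinearMap.opNorm_le_bound _ hC fun x => le_of_sq_le_sq ?_ (by positivity)
  rw [mul_pow]
  refine hasSum_le (fun i => ?_) (hasSum_norm_sq_inner e _) ((hasSum_norm_sq_inner e x).mul_left _)
  rw [inner_diagOp e hm, norm_mul, mul_pow]
  gcongr
  exact h i

theorem isSelfAdjoint_diagOp (hm : Summable m) (hm' : ∀ i, conj (m i) = m i) :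
    IsSelfAdjoint (diagOp e m) := by
  have hstar := (hasSum_diagOp e hm).star
  simp only [star_smul, ContinuousLinearMap.star_eq_adjoint, InnerProductSpace.adjoint_rankOne,
    Complex.star_def, hm'] at hstar
  exact hstar.unique (hasSum_diagOp e hm)

theorem injective_diagOp (hm : Summable m) (hm0 : ∀ i, m i ≠ 0) :
    Function.Injective (diagOp e m) := by
  intro x y h
  refine ext_inner_basis e fun i => mul_left_cancel₀ (hm0 i) ?_
  rw [← inner_diagOp e hm, ← inner_diagOp e hm, h]

theorem exists_eq_diagOp_diagOp_iff (hm : Summable m) (hm0 : ∀ i, m i ≠ 0) {x : H} :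
    (∃ y, x = diagOp e m (diagOp e m y)) ↔
      Summable fun i => ‖(m i ^ 2)⁻¹ * inner ℂ (e i) x‖ ^ 2 := by
  have hinner (i : ι) (y : H) :
      inner ℂ (e i) (diagOp e m (diagOp e m y)) = m i ^ 2 * inner ℂ (e i) y := by
    rw [inner_diagOp e hm, inner_diagOp e hm, sq, mul_assoc]
  constructor
  · rintro ⟨y, rfl⟩
    refine (hasSum_norm_sq_inner e y).summable.congr fun i => ?_
    rw [hinner, inv_mul_cancel_left₀ (pow_ne_zero 2 (hm0 i))]
  · intro h
    obtain ⟨y, hy⟩ := exists_forall_inner_basis_eq e h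
    refine ⟨y, ext_inner_basis e fun i => ?_⟩
    rw [hinner, hy, mul_inv_cancel_left₀ (pow_ne_zero 2 (hm0 i))]

end DiagonalOperator

section MulComp

variable {α K : Type*} [TopologicalSpace α] [MeasurableSpace α] [OpensMeasurableSpace α]
  [TopologicalSpace K] [CompactSpace K] {μ : Measure α} {π : C(α, K)}

/-- Multiplication on `L²(μ)` by the pullback `Q ∘ π` of a function on a compact space. For the
circle `π` is the identity, for the plane it is the quotient map `(x, y) ↦ x mod 2π`. -/
def mulComp (μ : Measure α) (π : C(α, K)) : C(K, ℂ) →ₗ[ℂ] Lp ℂ 2 μ →L[ℂ] Lp ℂ 2 μ :=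
  (mulOp μ).toLinearMap ∘ₗ
    { toFun := fun Q => (BoundedContinuousFunction.mkOfCompact Q).compContinuous π
      map_add' := fun _ _ => rfl
      map_smul' := fun _ _ => rfl }

theorem coeFn_mulComp (Q : C(K, ℂ)) (w : Lp ℂ 2 μ) :
    mulComp μ π Q w =ᵐ[μ] fun x => Q (π x) * w x :=
  coeFn_mulOp _ w

theorem norm_mulComp_le (Q : C(K, ℂ)) : ‖mulComp μ π Q‖ ≤ ‖Q‖ :=
  (norm_mulOp_le _).trans <|
    (BoundedContinuousFunction.norm_le (norm_nonneg Q)).2 fun x => Q.norm_coe_le_norm (π x)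

theorem isSelfAdjoint_mulComp {Q : C(K, ℂ)} (hQ : ∀ x, conj (Q x) = Q x) :
    IsSelfAdjoint (mulComp μ π Q) :=
  isSelfAdjoint_mulOp fun x => hQ (π x)

theorem re_inner_mulComp_le_add (Q Q' : C(K, ℂ)) (w : Lp ℂ 2 μ) :
    (inner ℂ w (mulComp μ π Q' w)).re ≤
      (inner ℂ w (mulComp μ π Q w)).re + ‖Q' - Q‖ * ‖w‖ ^ 2 := by
  have hle : (inner ℂ w (mulComp μ π (Q' - Q) w)).re ≤ ‖Q' - Q‖ * ‖w‖ ^ 2 :=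
    calc (inner ℂ w (mulComp μ π (Q' - Q) w)).re
        ≤ ‖w‖ * ‖mulComp μ π (Q' - Q) w‖ := re_inner_le_norm (𝕜 := ℂ) w _
      _ ≤ ‖w‖ * (‖Q' - Q‖ * ‖w‖) := by
          gcongr
          exact (mulComp μ π (Q' - Q)).le_of_opNorm_le (norm_mulComp_le _) w
      _ = ‖Q' - Q‖ * ‖w‖ ^ 2 := by ring
  rw [map_sub, _root_.sub_apply, inner_sub_right, Complex.sub_re] at hle
  linarith

end MulComp

section CirclePotential

variable {s b ε : ℝ} {u : ℝ → ℝ}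

/-- The zeroth-order coefficient `ε² + 2b u - 3s u²` as a function on the circle. -/
def circlePotential (s b ε : ℝ) (hu : Continuous u) (hper : Function.Periodic u (2 * Real.pi)) :
    C(Circle2Pi, ℂ) where
  toFun θ := ((AddCircle.liftIco (2 * Real.pi) 0 (potential s b ε u) θ : ℝ) : ℂ)
  continuous_toFun := by
    refine Complex.continuous_ofReal.comp (AddCircle.liftIco_zero_continuous ?_ ?_)
    · simp only [potential, hper.eq]
    · unfold potential
      fun_prop

theorem circlePotential_apply (hu : Continuous u) (hper : Function.Periodic u (2 * Real.pi))
    (θ : Circle2Pi) : circlePotential s b ε hu hper θ =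
      ((AddCircle.liftIco (2 * Real.pi) 0 (potential s b ε u) θ : ℝ) : ℂ) :=
  rfl

theorem circlePotential_coe (hu : Continuous u) (hper : Function.Periodic u (2 * Real.pi))
    (x : ℝ) : circlePotential s b ε hu hper (x : Circle2Pi) = (potential s b ε u x : ℂ) := by
  obtain ⟨m, hm, -⟩ := existsUnique_add_zsmul_mem_Ico Real.two_pi_pos x 0
  have hx : ((x + m • (2 * Real.pi) : ℝ) : Circle2Pi) = (x : Circle2Pi) := by
    rw [AddCircle.coe_add, AddCircle.coe_zsmul, AddCircle.coe_period, smul_zero, add_zero]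
  rw [← hx, circlePotential_apply, AddCircle.liftIco_coe_apply hm, potential, potential,
    hper.zsmul m x]

theorem conj_circlePotential (hu : Continuous u) (hper : Function.Periodic u (2 * Real.pi))
    (θ : Circle2Pi) :
    conj (circlePotential s b ε hu hper θ) = circlePotential s b ε hu hper θ :=
  Complex.conj_ofReal _

end CirclePotential

section BlochPoint

variable {ε ω κ : ℝ}

/-- The frequency of the Bloch wave `exp (i (n + σ₁) x + i σ₂ y)`. -/
def blochPoint (σ : ℝ × ℝ) (n : ℤ) : Plane :=
  !₂[(n + σ.1) / (2 * Real.pi), σ.2 / (2 * Real.pi)]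

theorem planeSymbol_blochPoint (σ : ℝ × ℝ) (n : ℤ) :
    planeSymbol ε ω (blochPoint σ n) = 1 - (1 + 2 * ε * ω) * (n + σ.1) ^ 2 - σ.2 ^ 2 := by
  simp only [planeSymbol, blochPoint, PiLp.toLp_apply, Matrix.cons_val_zero, Matrix.cons_val_one]
  field_simp

theorem blochSymbol_eq (σ : ℝ × ℝ) (n : ℤ) :
    blochSymbol ε ω σ n = -(planeSymbol ε ω (blochPoint σ n) : ℂ) ^ 2 := by
  rw [planeSymbol_blochPoint, blochSymbol, ← mul_add, mul_pow, Complex.I_sq]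
  push_cast
  ring

theorem norm_sq_blochPoint (σ : ℝ × ℝ) (n : ℤ) :
    (2 * Real.pi) ^ 2 * ‖blochPoint σ n‖ ^ 2 = (n + σ.1) ^ 2 + σ.2 ^ 2 := by
  rw [EuclideanSpace.real_norm_sq_eq, Fin.sum_univ_two]
  simp only [blochPoint, PiLp.toLp_apply, Matrix.cons_val_zero, Matrix.cons_val_one]
  field_simp

theorem one_add_norm_sq_blochPoint_le (σ : ℝ × ℝ) (n : ℤ) :
    1 + ‖blochPoint σ n‖ ^ 2 ≤ (3 + 2 * σ.1 ^ 2 + σ.2 ^ 2) * (1 + (n : ℝ) ^ 2) := by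
  have hnorm : ‖blochPoint σ n‖ ^ 2 ≤ (n + σ.1) ^ 2 + σ.2 ^ 2 := by
    have h2π : 1 ≤ (2 * Real.pi) ^ 2 := by nlinarith only [Real.pi_gt_three]
    rw [← norm_sq_blochPoint]
    exact le_mul_of_one_le_left (sq_nonneg _) h2π
  have hrem : 0 ≤ ((n : ℝ) - σ.1) ^ 2 + (2 * σ.1 ^ 2 + σ.2 ^ 2 + 1) * (n : ℝ) ^ 2 + 2 := by
    positivity
  linear_combination hnorm + hrem

theorem one_add_sq_le_blochPoint (σ : ℝ × ℝ) (n : ℤ) :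
    1 + (n : ℝ) ^ 2 ≤
      (1 + 2 * (2 * Real.pi) ^ 2 + 2 * σ.1 ^ 2) * (1 + ‖blochPoint σ n‖ ^ 2) := by
  have hrem : 0 ≤ ((n : ℝ) + 2 * σ.1) ^ 2 + 2 * σ.2 ^ 2 + 2 * (2 * Real.pi) ^ 2
      + (1 + 2 * σ.1 ^ 2) * ‖blochPoint σ n‖ ^ 2 := by positivity
  linear_combination hrem + 2 * (norm_sq_blochPoint σ n).ge

theorem summable_inv_one_add_sq : Summable fun n : ℤ => (1 + (n : ℝ) ^ 2)⁻¹ := by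
  refine (Real.summable_one_div_int_pow.2 one_lt_two).of_norm_bounded_eventually ?_
  filter_upwards [(Set.finite_singleton (0 : ℤ)).compl_mem_cofinite] with n hn
  have hn0 : (n : ℝ) ≠ 0 := Int.cast_ne_zero.2 hn
  rw [Real.norm_of_nonneg (by positivity), one_div]
  gcongr
  exact le_add_of_nonneg_left zero_le_one

end BlochPoint

section CircleResolvent

variable {ε ω κ : ℝ} {σ : ℝ × ℝ}

/-- The values of `planeWeight`, the function `(a² + κ)^(-1/2)`, at the frequencies of the Bloch
waves with parameter `σ`. -/
def blochWeight (ε ω : ℝ) (hκ : 0 < κ) (σ : ℝ × ℝ) (n : ℤ) : ℂ :=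
  planeWeight ε ω hκ (blochPoint σ n)

theorem blochWeight_ne_zero (hκ : 0 < κ) (n : ℤ) : blochWeight ε ω hκ σ n ≠ 0 :=
  planeWeight_ne_zero hκ _

theorem blochWeight_sq_mul (hκ : 0 < κ) (n : ℤ) :
    blochWeight ε ω hκ σ n ^ 2 * ((planeSymbol ε ω (blochPoint σ n) : ℂ) ^ 2 + κ) = 1 :=
  resolventWeight_sq_mul hκ _

theorem exists_norm_blochWeight_le (hk : 0 < 1 + 2 * ε * ω) (hκ : 0 < κ) (σ : ℝ × ℝ) :
    ∃ C, ∀ n : ℤ, ‖blochWeight ε ω hκ σ n‖ ≤ C * (1 + (n : ℝ) ^ 2)⁻¹ := by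
  obtain ⟨C, hC⟩ := exists_norm_planeWeight_le hk hκ
  have hC0 : 0 ≤ C := nonneg_of_mul_nonneg_left ((norm_nonneg _).trans (hC 0)) (by positivity)
  refine ⟨C * (1 + 2 * (2 * Real.pi) ^ 2 + 2 * σ.1 ^ 2), fun n => (hC _).trans ?_⟩
  rw [mul_assoc]
  gcongr
  rw [← div_eq_mul_inv, inv_le_comm₀ (by positivity) (by positivity), inv_div,
    div_le_iff₀ (by positivity), mul_comm]
  exact one_add_sq_le_blochPoint σ n

theorem exists_inv_le_norm_blochWeight (hk : 0 < 1 + 2 * ε * ω) (hκ : 0 < κ) (σ : ℝ × ℝ) :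
    ∃ C, ∀ n : ℤ, (1 + (n : ℝ) ^ 2)⁻¹ ≤ C * ‖blochWeight ε ω hκ σ n‖ := by
  obtain ⟨C, hC⟩ := exists_inv_le_norm_planeWeight hk hκ
  refine ⟨(3 + 2 * σ.1 ^ 2 + σ.2 ^ 2) * C, fun n => ?_⟩
  rw [mul_assoc]
  refine le_trans ?_ (mul_le_mul_of_nonneg_left (hC _) (by positivity))
  rw [← div_eq_mul_inv, inv_le_comm₀ (by positivity) (by positivity), inv_div,
    div_le_iff₀ (by positivity), mul_comm]
  exact one_add_norm_sq_blochPoint_le σ n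

theorem summable_blochWeight (hk : 0 < 1 + 2 * ε * ω) (hκ : 0 < κ) :
    Summable (blochWeight ε ω hκ σ) := by
  obtain ⟨C, hC⟩ := exists_norm_blochWeight_le hk hκ σ
  exact .of_norm_bounded (summable_inv_one_add_sq.mul_left C) hC

/-- The diagonal operator `([1 + (1 + 2εω)(∂ₓ + iσ₁)² - σ₂²]² + κ)^(-1/2)` on `L²(𝕋)`. -/
def circleN (ε ω : ℝ) (hκ : 0 < κ) (σ : ℝ × ℝ) : L2Circle →L[ℂ] L2Circle :=
  diagOp fourierBasis (blochWeight ε ω hκ σ)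

theorem isSelfAdjoint_circleN (hk : 0 < 1 + 2 * ε * ω) (hκ : 0 < κ) :
    IsSelfAdjoint (circleN ε ω hκ σ) :=
  isSelfAdjoint_diagOp _ (summable_blochWeight hk hκ) fun _ => conj_resolventWeight hκ _

theorem injective_circleN (hk : 0 < 1 + 2 * ε * ω) (hκ : 0 < κ) :
    Function.Injective (circleN ε ω hκ σ) :=
  injective_diagOp _ (summable_blochWeight hk hκ) (blochWeight_ne_zero hκ)

theorem norm_circleN_sq_le (hk : 0 < 1 + 2 * ε * ω) (hκ : 0 < κ) :
    ‖circleN ε ω hκ σ‖ ^ 2 ≤ κ⁻¹ := by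
  have h : ‖circleN ε ω hκ σ‖ ≤ (√κ)⁻¹ :=
    norm_diagOp_le _ (summable_blochWeight hk hκ) (by positivity) fun n =>
      ((resolventWeight hκ).norm_coe_le_norm _).trans (norm_resolventWeight_le hκ)
  calc ‖circleN ε ω hκ σ‖ ^ 2 ≤ (√κ)⁻¹ ^ 2 := by gcongr
    _ = κ⁻¹ := by rw [inv_pow, Real.sq_sqrt hκ.le]

theorem fourierCoeff_eq_inner (f : L2Circle) (n : ℤ) :
    fourierCoeff f n = inner ℂ (fourierBasis (T := 2 * Real.pi) n) f := by
  rw [← fourierBasis_repr, HilbertBasis.repr_apply_apply]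

theorem summable_mul_norm_sq_of_le {m m' : ℤ → ℝ} (hm : ∀ n, 0 ≤ m n) {C : ℝ}
    (hmm' : ∀ n, m n ≤ C * m' n) {c : ℤ → ℂ} (h : Summable fun n => m' n ^ 4 * ‖c n‖ ^ 2) :
    Summable fun n => m n ^ 4 * ‖c n‖ ^ 2 := by
  refine .of_nonneg_of_le (fun n => by positivity) (fun n => ?_) (h.mul_left (C ^ 4))
  rw [← mul_assoc, ← mul_pow]
  have := hm n
  gcongr
  exact hmm' n

theorem memH4Circle_iff (hk : 0 < 1 + 2 * ε * ω) (hκ : 0 < κ) {W : L2Circle} :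
    MemH4Circle W ↔ ∃ v, W = circleN ε ω hκ σ (circleN ε ω hκ σ v) := by
  have hnorm (n : ℤ) : ‖(blochWeight ε ω hκ σ n ^ 2)⁻¹ *
      inner ℂ (fourierBasis (T := 2 * Real.pi) n) W‖ ^ 2 =
      ‖blochWeight ε ω hκ σ n‖⁻¹ ^ 4 * ‖fourierCoeff W n‖ ^ 2 := by
    rw [fourierCoeff_eq_inner, norm_mul, norm_inv, norm_pow]
    ring
  have hpos (n : ℤ) : 0 < ‖blochWeight ε ω hκ σ n‖ := norm_pos_iff.2 (blochWeight_ne_zero hκ n)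
  simp only [circleN, exists_eq_diagOp_diagOp_iff _ (summable_blochWeight hk hκ)
    (blochWeight_ne_zero hκ), MemH4Circle, hnorm]
  obtain ⟨A, hA⟩ := exists_norm_blochWeight_le hk hκ σ
  obtain ⟨B, hB⟩ := exists_inv_le_norm_blochWeight hk hκ σ
  constructor
  · refine summable_mul_norm_sq_of_le (fun n => (inv_pos.2 (hpos n)).le) (C := B) fun n => ?_
    have := hB n
    rw [inv_le_iff_one_le_mul₀ (hpos n)]
    rw [inv_le_iff_one_le_mul₀ (by positivity)] at this
    linarith
  · refine summable_mul_norm_sq_of_le (fun n => by positivity) (C := A) fun n => ?_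
    have := hA n
    rw [← div_eq_mul_inv, le_div_iff₀ (by positivity)] at this
    rw [← div_eq_mul_inv, le_div_iff₀ (hpos n)]
    linarith

variable {s b : ℝ} {u : ℝ → ℝ} {V : L2Circle →L[ℂ] L2Circle}

theorem blochGraph_iff_forall_fourierCoeff
    (hV : ∀ W, V W =ᵐ[AddCircle.haarAddCircle] fun θ =>
      ((AddCircle.liftIco (2 * Real.pi) 0 (potential s b ε u) θ : ℝ) : ℂ) * W θ)
    {W G : L2Circle} :
    BlochGraph s b ε ω u σ W G ↔ MemH4Circle W ∧ ∀ n : ℤ,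
      fourierCoeff G n = blochSymbol ε ω σ n * fourierCoeff W n + fourierCoeff (V W) n := by
  refine and_congr_right fun _ => ⟨?_, fun h => ⟨V W, hV W, h⟩⟩
  rintro ⟨Q, hQ, h⟩
  have hQV : Q = V W := by
    refine Lp.ext ?_
    filter_upwards [hQ, hV W] with θ hθ hθ' using hθ.trans hθ'.symm
  rwa [← hQV]

theorem blochGraph_iff
    (hV : ∀ W, V W =ᵐ[AddCircle.haarAddCircle] fun θ =>
      ((AddCircle.liftIco (2 * Real.pi) 0 (potential s b ε u) θ : ℝ) : ℂ) * W θ)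
    (hk : 0 < 1 + 2 * ε * ω) (hκ : 0 < κ) {W G : L2Circle} :
    BlochGraph s b ε ω u σ W G ↔
      W = circleN ε ω hκ σ (circleN ε ω hκ σ ((κ : ℂ) • W - G + V W)) := by
  have hgraph {v : L2Circle} (hv : W = circleN ε ω hκ σ (circleN ε ω hκ σ v)) :
      (∀ n : ℤ, fourierCoeff G n = blochSymbol ε ω σ n * fourierCoeff W n
        + fourierCoeff (V W) n) ↔ v = (κ : ℂ) • W - G + V W := by
    have hcoeff (n : ℤ) : ((planeSymbol ε ω (blochPoint σ n) : ℂ) ^ 2 + κ) *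
        inner ℂ (fourierBasis (T := 2 * Real.pi) n) W =
          inner ℂ (fourierBasis (T := 2 * Real.pi) n) v := by
      rw [hv, circleN, inner_diagOp _ (summable_blochWeight hk hκ),
        inner_diagOp _ (summable_blochWeight hk hκ)]
      linear_combination inner ℂ (fourierBasis n) v * blochWeight_sq_mul hκ n
    rw [show v = (κ : ℂ) • W - G + V W ↔ ∀ n : ℤ, inner ℂ (fourierBasis (T := 2 * Real.pi) n) v =
        inner ℂ (fourierBasis (T := 2 * Real.pi) n) ((κ : ℂ) • W - G + V W) from
      ⟨fun h n => by rw [h], ext_inner_basis _⟩]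
    refine forall_congr' fun n => ?_
    rw [← hcoeff, blochSymbol_eq, inner_add_right, inner_sub_right, inner_smul_right]
    simp only [fourierCoeff_eq_inner]
    constructor <;> intro h <;> linear_combination h
  rw [blochGraph_iff_forall_fourierCoeff hV, memH4Circle_iff (σ := σ) hk hκ]
  constructor
  · rintro ⟨⟨v, hv⟩, hg⟩
    exact (hgraph hv).1 hg ▸ hv
  · exact fun hW => ⟨⟨_, hW⟩, (hgraph hW).2 rfl⟩

end CircleResolvent

section BlochSpectrum

variable {s b ε ω κ : ℝ} {u : ℝ → ℝ} {σ : ℝ × ℝ}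

/-- Multiplication by a continuous function on `L²(𝕋)`. -/
def circleMul : C(Circle2Pi, ℂ) →ₗ[ℂ] L2Circle →L[ℂ] L2Circle :=
  mulComp AddCircle.haarAddCircle (.id Circle2Pi)

theorem coeFn_circleMul (Q : C(Circle2Pi, ℂ)) (W : L2Circle) :
    circleMul Q W =ᵐ[AddCircle.haarAddCircle] fun θ => Q θ * W θ :=
  coeFn_mulComp Q W

variable (hu : Continuous u) (hper : Function.Periodic u (2 * Real.pi))

/-- The resolvent `(κ - B(σ))⁻¹` of the Bloch operator. The value is junk unless `κ` is large. -/
def blochResolvent (s b ε ω : ℝ) (hκ : 0 < κ) (σ : ℝ × ℝ) : L2Circle →L[ℂ] L2Circle :=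
  perturbedResolvent (circleN ε ω hκ σ) (circleMul (circlePotential s b ε hu hper))

variable {hu hper}

theorem isStrictlyPositive_one_sub_circle (hk : 0 < 1 + 2 * ε * ω) (hκ : 0 < κ)
    (hVκ : ‖circlePotential s b ε hu hper‖ < κ) :
    IsStrictlyPositive (1 - circleN ε ω hκ σ * circleMul (circlePotential s b ε hu hper) *
      circleN ε ω hκ σ) :=
  isStrictlyPositive_one_sub_mul_mul (isSelfAdjoint_circleN hk hκ)
    (isSelfAdjoint_mulComp (conj_circlePotential hu hper)) (norm_circleN_sq_le hk hκ)
    ((norm_mulComp_le _).trans_lt hVκ)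

theorem blochGraph_iff_eq_blochResolvent (hk : 0 < 1 + 2 * ε * ω) (hκ : 0 < κ)
    (hVκ : ‖circlePotential s b ε hu hper‖ < κ) {W G : L2Circle} :
    BlochGraph s b ε ω u σ W G ↔
      W = blochResolvent hu hper s b ε ω hκ σ ((κ : ℂ) • W - G) := by
  rw [blochGraph_iff (coeFn_circleMul (circlePotential s b ε hu hper)) hk hκ, blochResolvent,
    eq_perturbedResolvent_iff (isStrictlyPositive_one_sub_circle hk hκ hVκ).isUnit]

theorem le_norm_circlePotential_of_mem_blochEigenvalues (hk : 0 < 1 + 2 * ε * ω) {μ : ℝ}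
    (hμ : μ ∈ blochEigenvalues s b ε ω u) : μ ≤ ‖circlePotential s b ε hu hper‖ := by
  obtain ⟨σ, W, hW0, hW⟩ := hμ
  by_contra! hVμ
  rw [blochGraph_iff_eq_blochResolvent hk ((norm_nonneg _).trans_lt hVμ) hVμ, sub_self,
    map_zero] at hW
  exact hW0 hW

theorem blochResolvent_ne_zero (hk : 0 < 1 + 2 * ε * ω) (hκ : 0 < κ)
    (hVκ : ‖circlePotential s b ε hu hper‖ < κ) : blochResolvent hu hper s b ε ω hκ σ ≠ 0 := by
  intro h
  have hinj : Function.Injective (blochResolvent hu hper s b ε ω hκ σ) :=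
    injective_perturbedResolvent (isStrictlyPositive_one_sub_circle hk hκ hVκ).isUnit
      (injective_circleN hk hκ)
  have he : fourierBasis (T := 2 * Real.pi) 0 = 0 := hinj (by rw [h]; rfl)
  simpa [he] using (fourierBasis (T := 2 * Real.pi)).orthonormal.1 0

theorem sub_inv_norm_mem_blochEigenvalues (hk : 0 < 1 + 2 * ε * ω) (hκ : 0 < κ)
    (hVκ : ‖circlePotential s b ε hu hper‖ < κ) (σ : ℝ × ℝ) :
    κ - ‖blochResolvent hu hper s b ε ω hκ σ‖⁻¹ ∈ blochEigenvalues s b ε ω u := by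
  let R := blochResolvent hu hper s b ε ω hκ σ
  have hR : 0 ≤ R := perturbedResolvent_nonneg (isSelfAdjoint_circleN hk hκ)
    (isStrictlyPositive_one_sub_circle hk hκ hVκ)
  have hRc : IsCompactOperator R :=
    isCompactOperator_perturbedResolvent
      (isCompactOperator_diagOp fourierBasis (summable_blochWeight hk hκ))
  have hRne : R ≠ 0 := blochResolvent_ne_zero hk hκ hVκ
  obtain ⟨W, hW0, hW⟩ := exists_eigenvector_norm hR hRc hRne
  refine ⟨σ, W, hW0, (blochGraph_iff_eq_blochResolvent hk hκ hVκ).2 ?_⟩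
  calc W = (‖R‖ : ℂ)⁻¹ • R W := by
        rw [hW, smul_smul, inv_mul_cancel₀ (by simpa using hRne), one_smul]
    _ = R ((‖R‖ : ℂ)⁻¹ • W) := (map_smul R _ W).symm
    _ = R ((κ : ℂ) • W - ((κ - ‖R‖⁻¹ : ℝ) : ℂ) • W) := by
        rw [← sub_smul, ← Complex.ofReal_sub, sub_sub_cancel, Complex.ofReal_inv]

theorem isLUB_maxGrowthRate (hu : Continuous u) (hper : Function.Periodic u (2 * Real.pi))
    (hk : 0 < 1 + 2 * ε * ω) :
    IsLUB (blochEigenvalues s b ε ω u) (maxGrowthRate s b ε ω u) :=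
  Real.isLUB_sSup
    ⟨_, sub_inv_norm_mem_blochEigenvalues hk
      (add_pos_of_nonneg_of_pos (norm_nonneg (circlePotential s b ε hu hper)) one_pos)
      (lt_add_one _) 0⟩
    ⟨_, fun _ => le_norm_circlePotential_of_mem_blochEigenvalues (hu := hu) (hper := hper) hk⟩

theorem maxGrowthRate_le_norm_circlePotential (hk : 0 < 1 + 2 * ε * ω) :
    maxGrowthRate s b ε ω u ≤ ‖circlePotential s b ε hu hper‖ :=
  (isLUB_maxGrowthRate hu hper hk).2 fun _ => le_norm_circlePotential_of_mem_blochEigenvalues hk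

theorem norm_blochResolvent_le (hk : 0 < 1 + 2 * ε * ω) (hκ : 0 < κ)
    (hVκ : ‖circlePotential s b ε hu hper‖ < κ) :
    ‖blochResolvent hu hper s b ε ω hκ σ‖ ≤ (κ - maxGrowthRate s b ε ω u)⁻¹ := by
  have hpos : 0 < ‖blochResolvent hu hper s b ε ω hκ σ‖ :=
    norm_pos_iff.2 (blochResolvent_ne_zero hk hκ hVκ)
  have hle : κ - ‖blochResolvent hu hper s b ε ω hκ σ‖⁻¹ ≤ maxGrowthRate s b ε ω u :=
    (isLUB_maxGrowthRate hu hper hk).1 (sub_inv_norm_mem_blochEigenvalues hk hκ hVκ σ)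
  have hgap : 0 < κ - maxGrowthRate s b ε ω u :=
    sub_pos.2 ((maxGrowthRate_le_norm_circlePotential hk).trans_lt hVκ)
  rw [le_inv_comm₀ hpos hgap]
  linarith

/-- The spectral bound on the Bloch operator `B(σ)`, tested on trigonometric polynomials. -/
theorem re_inner_circleMul_circlePotential_le (hk : 0 < 1 + 2 * ε * ω) (σ : ℝ × ℝ)
    (S : Finset ℤ) (a : ℤ → ℂ) :
    (inner ℂ (∑ n ∈ S, a n • fourierBasis n)
      (circleMul (circlePotential s b ε hu hper) (∑ n ∈ S, a n • fourierBasis n))).re ≤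
      ∑ n ∈ S, (planeSymbol ε ω (blochPoint σ n) ^ 2 + maxGrowthRate s b ε ω u) * ‖a n‖ ^ 2 := by
  let κ := ‖circlePotential s b ε hu hper‖ + 1
  have hVκ : ‖circlePotential s b ε hu hper‖ < κ := lt_add_one _
  have hκ : 0 < κ := (norm_nonneg _).trans_lt hVκ
  have hgap : 0 < κ - maxGrowthRate s b ε ω u :=
    sub_pos.2 ((maxGrowthRate_le_norm_circlePotential hk).trans_lt hVκ)
  let m := blochWeight ε ω hκ σ
  have hNv : circleN ε ω hκ σ (∑ n ∈ S, ((m n)⁻¹ * a n) • fourierBasis n) =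
      ∑ n ∈ S, a n • fourierBasis n := by
    rw [map_sum]
    refine Finset.sum_congr rfl fun n _ => ?_
    rw [map_smul, circleN, diagOp_basis _ (summable_blochWeight hk hκ), smul_smul,
      mul_right_comm, inv_mul_cancel₀ (blochWeight_ne_zero hκ n), one_mul]
  have hnorm (n : ℤ) :
      ‖(m n)⁻¹ * a n‖ ^ 2 = (planeSymbol ε ω (blochPoint σ n) ^ 2 + κ) * ‖a n‖ ^ 2 := by
    have hm : (m n ^ 2)⁻¹ = (planeSymbol ε ω (blochPoint σ n) : ℂ) ^ 2 + κ :=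
      inv_eq_of_mul_eq_one_right (blochWeight_sq_mul hκ n)
    rw [norm_mul, mul_pow, ← norm_pow, inv_pow, hm, ← Complex.ofReal_pow, ← Complex.ofReal_add,
      Complex.norm_real, Real.norm_of_nonneg (by positivity)]
  have hform := (norm_perturbedResolvent_le_iff (isSelfAdjoint_circleN (σ := σ) hk hκ)
    (isStrictlyPositive_one_sub_circle hk hκ hVκ) (inv_pos.2 hgap)).1
    (norm_blochResolvent_le hk hκ hVκ) (∑ n ∈ S, ((m n)⁻¹ * a n) • fourierBasis n)
  rw [hNv, inv_inv, norm_sq_sum_smul_basis, norm_sq_sum_smul_basis, Finset.mul_sum] at hform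
  simp only [hnorm, sub_mul, add_mul, Finset.sum_sub_distrib, Finset.sum_add_distrib] at hform ⊢
  linarith

end BlochSpectrum

/-! ### From Bloch waves to the plane -/

theorem tendsto_window_average {t : ℤ → ℂ} (ht : Summable t) :
    Tendsto (fun K : ℕ => (K : ℝ)⁻¹ • ∑ n ∈ Finset.range K, ∑ m ∈ Finset.range K,
      t ((n : ℤ) - m)) atTop (𝓝 (∑' j, t j)) := by
  let d : ℕ → ℂ := fun K => ∑ i ∈ Finset.range (K + 1), t i +
    ∑ i ∈ Finset.range K, t (-((i : ℤ) + 1))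
  have hnat : Summable fun i : ℕ => t i := ht.comp_injective Nat.cast_injective
  have hneg : Summable fun i : ℕ => t (-((i : ℤ) + 1)) :=
    ht.comp_injective fun a b h => by simpa using h
  have hd : Tendsto d atTop (𝓝 (∑' j, t j)) := by
    rw [tsum_of_nat_of_neg_add_one hnat hneg]
    exact (hnat.hasSum.tendsto_sum_nat.comp (tendsto_add_atTop_nat 1)).add
      hneg.hasSum.tendsto_sum_nat
  have hsum (K : ℕ) : ∑ n ∈ Finset.range K, ∑ m ∈ Finset.range K, t ((n : ℤ) - m) =
      ∑ i ∈ Finset.range K, d i := by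
    induction K with
    | zero => simp
    | succ K ih =>
      have hcol : ∑ n ∈ Finset.range K, t ((n : ℤ) - K) =
          ∑ i ∈ Finset.range K, t (-((i : ℤ) + 1)) := by
        rw [← Finset.sum_range_reflect]
        refine Finset.sum_congr rfl fun i hi => congrArg t ?_
        have := Finset.mem_range.1 hi
        lia
      have hrow : ∑ m ∈ Finset.range (K + 1), t ((K : ℤ) - m) =
          ∑ i ∈ Finset.range (K + 1), t i := by
        rw [← Finset.sum_range_reflect]
        refine Finset.sum_congr rfl fun i hi => congrArg t ?_
        have := Finset.mem_range.1 hi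
        lia
      rw [Finset.sum_range_succ (fun i => d i), ← ih, Finset.sum_range_succ, hrow]
      simp only [Finset.sum_range_succ _ K, Finset.sum_add_distrib, hcol, d]
      ring
  simp only [hsum]
  exact hd.cesaro_smul

theorem re_sum_mul_integral_translate_le {E ι : Type*} [AddGroup E] [MeasurableSpace E]
    [MeasurableAdd₂ E] {μ : Measure E} [μ.IsAddRightInvariant] {G : E → ℂ} (hG : MemLp G 2 μ)
    {A : E → ℝ} (hA : Integrable (fun ξ => A ξ * ‖G ξ‖ ^ 2) μ) (τ : ι → E) (c : ι → ι → ℂ)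
    (S : Finset ι)
    (hpt : ∀ ξ, (∑ n ∈ S, ∑ m ∈ S, c n m * (conj (G (ξ + τ n)) * G (ξ + τ m))).re ≤
      ∑ n ∈ S, A (ξ + τ n) * ‖G (ξ + τ n)‖ ^ 2) :
    (∑ n ∈ S, ∑ m ∈ S, c n m * ∫ ξ, conj (G (ξ + τ n)) * G (ξ + τ m) ∂μ).re ≤
      S.card * ∫ ξ, A ξ * ‖G ξ‖ ^ 2 ∂μ := by
  have hτ (n : ι) : MemLp (fun ξ => G (ξ + τ n)) 2 μ :=
    hG.comp_measurePreserving (measurePreserving_add_right μ (τ n))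
  have hi (n m : ι) : Integrable (fun ξ => c n m * (conj (G (ξ + τ n)) * G (ξ + τ m))) μ :=
    ((hτ n).star.integrable_mul (hτ m)).const_mul _
  have hI : Integrable (fun ξ => ∑ n ∈ S, ∑ m ∈ S,
      c n m * (conj (G (ξ + τ n)) * G (ξ + τ m))) μ :=
    integrable_finsetSum _ fun n _ => integrable_finsetSum _ fun m _ => hi n m
  have hAτ (n : ι) : Integrable (fun ξ => A (ξ + τ n) * ‖G (ξ + τ n)‖ ^ 2) μ :=
    hA.comp_add_right (τ n)
  calc (∑ n ∈ S, ∑ m ∈ S, c n m * ∫ ξ, conj (G (ξ + τ n)) * G (ξ + τ m) ∂μ).re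
      = (∫ ξ, ∑ n ∈ S, ∑ m ∈ S, c n m * (conj (G (ξ + τ n)) * G (ξ + τ m)) ∂μ).re := by
        simp_rw [← integral_const_mul]
        rw [integral_finsetSum _ fun n _ => integrable_finsetSum _ fun m _ => hi n m]
        simp_rw [integral_finsetSum S fun m _ => hi _ m]
    _ = ∫ ξ, (∑ n ∈ S, ∑ m ∈ S, c n m * (conj (G (ξ + τ n)) * G (ξ + τ m))).re ∂μ :=
        (integral_re hI).symm
    _ ≤ ∫ ξ, ∑ n ∈ S, A (ξ + τ n) * ‖G (ξ + τ n)‖ ^ 2 ∂μ :=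
        integral_mono hI.re (integrable_finsetSum _ fun n _ => hAτ n) hpt
    _ = S.card * ∫ ξ, A ξ * ‖G ξ‖ ^ 2 ∂μ := by
        rw [integral_finsetSum _ fun n _ => hAτ n]
        simp only [integral_add_right_eq_self fun ξ => A ξ * ‖G ξ‖ ^ 2, Finset.sum_const,
          nsmul_eq_mul]

section Modulation

/-- Multiplication on `L²(ℝ²)` by a continuous function on the circle, read as a function of `x`
of period `2π`. -/
def planeMul : C(Circle2Pi, ℂ) →ₗ[ℂ] L2Plane →L[ℂ] L2Plane :=
  mulComp volume ⟨fun z : Plane => ((z 0 : ℝ) : Circle2Pi),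
    (AddCircle.continuous_mk' _).comp (by fun_prop)⟩

theorem coeFn_planeMul (Q : C(Circle2Pi, ℂ)) (w : L2Plane) :
    planeMul Q w =ᵐ[volume] fun z => Q ((z 0 : ℝ) : Circle2Pi) * w z :=
  coeFn_mulComp Q w

/-- The shift in frequency corresponding to multiplication by `exp (i x)`. -/
def frequencyShift : Plane := EuclideanSpace.single 0 (1 / (2 * Real.pi))

theorem fourierChar_inner_frequencyShift (j : ℤ) (z : Plane) :
    (Real.fourierChar (inner ℝ ((j : ℝ) • frequencyShift) z) : ℂ) =
      fourier j ((z 0 : ℝ) : Circle2Pi) := by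
  rw [fourier_coe_apply, Real.fourierChar_apply, inner_smul_left, frequencyShift,
    EuclideanSpace.inner_single_left]
  congr 1
  have : (Real.pi : ℂ) ≠ 0 := by exact_mod_cast Real.pi_ne_zero
  simp
  field_simp

theorem fourierInv_compSubConst_frequencyShift (ψ : 𝓢(Plane, ℂ)) (j : ℤ) (z : Plane) :
    𝓕⁻ (ψ.compSubConstCLM ℂ ((j : ℝ) • frequencyShift)) z =
      fourier j ((z 0 : ℝ) : Circle2Pi) * 𝓕⁻ ψ z := by
  rw [SchwartzMap.fourierInv_coe, SchwartzMap.fourierInv_coe, Real.fourierInv_eq,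
    Real.fourierInv_eq, ← fourierChar_inner_frequencyShift, ← integral_const_mul,
    ← integral_add_right_eq_self _ ((j : ℝ) • frequencyShift)]
  refine integral_congr_ae (Eventually.of_forall fun v => ?_)
  simp only [SchwartzMap.compSubConstCLM_apply, add_sub_cancel_right, Circle.smul_def,
    smul_eq_mul]
  rw [inner_add_left, AddChar.map_add_eq_mul, Circle.coe_mul]
  ring

/-- Translation on `L²(ℝ²)`. -/
def translation (η : Plane) : L2Plane →ₗᵢ[ℂ] L2Plane :=
  Lp.compMeasurePreservingₗᵢ ℂ (fun ξ => ξ - η) (measurePreserving_sub_right volume η)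

theorem coeFn_translation (η : Plane) (g : L2Plane) :
    translation η g =ᵐ[volume] fun ξ => g (ξ - η) :=
  Lp.coeFn_compMeasurePreserving g (measurePreserving_sub_right volume η)

theorem translation_toLp (η : Plane) (ψ : 𝓢(Plane, ℂ)) :
    translation η (ψ.toLp 2) = (ψ.compSubConstCLM ℂ η).toLp 2 := by
  refine Lp.ext ?_
  filter_upwards [coeFn_translation η (ψ.toLp 2),
    (measurePreserving_sub_right volume η).quasiMeasurePreserving.ae
      (ψ.coeFn_toLp 2 (volume : Measure Plane)),
    (ψ.compSubConstCLM ℂ η).coeFn_toLp 2 (volume : Measure Plane)] with ξ h₁ h₂ h₃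
  rw [h₁, h₂, h₃, SchwartzMap.compSubConstCLM_apply]

theorem fourierInv_translation_frequencyShift (j : ℤ) (g : L2Plane) :
    𝓕⁻ (translation ((j : ℝ) • frequencyShift) g) = planeMul (fourier j) (𝓕⁻ g) := by
  refine DenseRange.induction_on (SchwartzMap.denseRange_toLpCLM (E := Plane) (F := ℂ) (p := 2)
    (μ := volume) ENNReal.ofNat_ne_top) g (isClosed_eq ?_ ?_) fun ψ => ?_
  · exact (Lp.fourierTransformₗᵢ Plane ℂ).symm.continuous.comp (translation _).continuous
  · exact (planeMul (fourier j)).continuous.comp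
      (Lp.fourierTransformₗᵢ Plane ℂ).symm.continuous
  · rw [SchwartzMap.toLpCLM_apply, translation_toLp, SchwartzMap.toLp_fourierInv_eq,
      SchwartzMap.toLp_fourierInv_eq]
    refine Lp.ext ?_
    filter_upwards [coeFn_planeMul (fourier j) ((𝓕⁻ ψ).toLp 2 : L2Plane),
      (𝓕⁻ ψ).coeFn_toLp 2 (volume : Measure Plane),
      (𝓕⁻ (ψ.compSubConstCLM ℂ ((j : ℝ) • frequencyShift))).coeFn_toLp 2
        (volume : Measure Plane)] with z h₁ h₂ h₃
    rw [h₁, h₂, h₃, fourierInv_compSubConst_frequencyShift]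

theorem fourier_planeMul_fourier (j : ℤ) (w : L2Plane) :
    𝓕 (planeMul (fourier j) w) = translation ((j : ℝ) • frequencyShift) (𝓕 w) := by
  have h := fourierInv_translation_frequencyShift j (𝓕 w)
  rw [FourierTransform.fourierInv_fourier_eq] at h
  rw [← h, FourierTransform.fourier_fourierInv_eq]

theorem integral_conj_mul_translate (w : L2Plane) (n m : ℤ) :
    ∫ ξ, conj ((𝓕 w : L2Plane) (ξ + (n : ℝ) • frequencyShift)) *
      (𝓕 w : L2Plane) (ξ + (m : ℝ) • frequencyShift) =
      inner ℂ w (planeMul (fourier (n - m)) w) := by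
  rw [← Lp.inner_fourier_eq, fourier_planeMul_fourier, L2.inner_def,
    ← integral_add_right_eq_self (fun ξ => inner ℂ ((𝓕 w : L2Plane) ξ) _)
      ((n : ℝ) • frequencyShift)]
  refine integral_congr_ae ?_
  filter_upwards [(measurePreserving_add_right volume
    ((n : ℝ) • frequencyShift)).quasiMeasurePreserving.ae
      (coeFn_translation (((n - m : ℤ) : ℝ) • frequencyShift) (𝓕 w))] with ξ h
  rw [h, RCLike.inner_apply, mul_comm, Int.cast_sub, sub_smul,
    ← sub_add, add_sub_cancel_right]

end Modulation

theorem integral_norm_sq_eq {α : Type*} [MeasurableSpace α] {μ : Measure α} (f : Lp ℂ 2 μ) :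
    ∫ x, ‖f x‖ ^ 2 ∂μ = ‖f‖ ^ 2 := by
  rw [@norm_sq_eq_re_inner ℂ, L2.inner_def, ← integral_re (L2.integrable_inner f f)]
  exact integral_congr_ae (Eventually.of_forall fun x => norm_sq_eq_re_inner (𝕜 := ℂ) (f x))

section WindowTransfer

theorem inner_fourierBasis_circleMul (Q : C(Circle2Pi, ℂ)) (n m : ℤ) :
    inner ℂ (fourierBasis n) (circleMul Q (fourierBasis m)) = fourierCoeff Q (n - m) := by
  rw [← fourierCoeff_eq_inner, fourierCoeff, fourierCoeff]
  refine integral_congr_ae ?_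
  have hm := coeFn_circleMul Q (fourierBasis m)
  rw [coe_fourierBasis] at hm ⊢
  filter_upwards [hm, coeFn_fourierLp (T := 2 * Real.pi) 2 m] with θ h₁ h₂
  rw [h₁, h₂, smul_eq_mul, smul_eq_mul, neg_sub, sub_eq_neg_add, fourier_add]
  ring

theorem inner_sum_circleMul_sum (Q : C(Circle2Pi, ℂ)) (S : Finset ℤ) (a : ℤ → ℂ) :
    inner ℂ (∑ n ∈ S, a n • fourierBasis n) (circleMul Q (∑ n ∈ S, a n • fourierBasis n)) =
      ∑ n ∈ S, ∑ m ∈ S, fourierCoeff Q (n - m) * (conj (a n) * a m) := by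
  rw [map_sum, sum_inner]
  refine Finset.sum_congr rfl fun n _ => ?_
  rw [inner_sum]
  refine Finset.sum_congr rfl fun m _ => ?_
  rw [map_smul, inner_smul_left, inner_smul_right, inner_fourierBasis_circleMul]
  ring

theorem hasSum_fourierCoeff_mul_inner_planeMul {P : C(Circle2Pi, ℂ)}
    (hP : P ∈ Submodule.span ℂ (Set.range (fourier (T := 2 * Real.pi)))) (w : L2Plane) :
    HasSum (fun j => fourierCoeff P j * inner ℂ w (planeMul (fourier j) w))
      (inner ℂ w (planeMul P w)) := by
  have hcoeff (P : C(Circle2Pi, ℂ)) (j : ℤ) :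
      fourierCoeff P j = inner ℂ (fourierBasis j) (circleMul P (fourierBasis 0)) := by
    rw [inner_fourierBasis_circleMul, sub_zero]
  simp only [hcoeff]
  induction hP using Submodule.span_induction with
  | mem _ hk =>
    obtain ⟨k, rfl⟩ := hk
    simp only [← hcoeff]
    convert! hasSum_single k fun j hj => ?_
    · rw [fourierCoeff_fourier, Pi.single_eq_same, one_mul]
    · rw [fourierCoeff_fourier, Pi.single_eq_of_ne hj, zero_mul]
  | zero => simp
  | add P P' _ _ hP hP' => simpa [inner_add_right, add_mul] using hP.add hP'
  | smul c P _ hP => simpa [inner_smul_right, mul_assoc] using hP.mul_left c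

theorem blochPoint_eq_add (ξ : Plane) (n : ℤ) :
    blochPoint (2 * Real.pi * ξ 0, 2 * Real.pi * ξ 1) n = ξ + (n : ℝ) • frequencyShift := by
  have hpi := Real.pi_ne_zero
  ext i
  fin_cases i
  · simp [blochPoint, frequencyShift]
    field_simp
    ring
  · simp [blochPoint, frequencyShift]

variable {Q : C(Circle2Pi, ℂ)} {A : Plane → ℝ}

theorem re_inner_planeMul_le_of_mem_span
    (hQ : Q ∈ Submodule.span ℂ (Set.range (fourier (T := 2 * Real.pi))))
    (hform : ∀ (ξ : Plane) (S : Finset ℤ) (a : ℤ → ℂ),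
      (inner ℂ (∑ n ∈ S, a n • fourierBasis n)
        (circleMul Q (∑ n ∈ S, a n • fourierBasis n))).re ≤
        ∑ n ∈ S, A (ξ + (n : ℝ) • frequencyShift) * ‖a n‖ ^ 2)
    {w : L2Plane} (hA : Integrable fun ξ => A ξ * ‖(𝓕 w : L2Plane) ξ‖ ^ 2) :
    (inner ℂ w (planeMul Q w)).re ≤ ∫ ξ, A ξ * ‖(𝓕 w : L2Plane) ξ‖ ^ 2 := by
  have hsum := hasSum_fourierCoeff_mul_inner_planeMul hQ w
  have hlim := (Complex.continuous_re.tendsto _).comp (tendsto_window_average hsum.summable)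
  rw [hsum.tsum_eq] at hlim
  refine le_of_tendsto hlim ?_
  filter_upwards [eventually_gt_atTop 0] with K hK
  have hwindow := re_sum_mul_integral_translate_le (Lp.memLp (𝓕 w : L2Plane)) hA
    (fun n : ℤ => (n : ℝ) • frequencyShift) (fun n m => fourierCoeff Q (n - m))
    ((Finset.range K).map Nat.castEmbedding) fun ξ => by
      rw [← inner_sum_circleMul_sum Q _ fun n => (𝓕 w : L2Plane) (ξ + (n : ℝ) • frequencyShift)]
      exact hform ξ _ _
  simp only [integral_conj_mul_translate, Finset.sum_map, Nat.castEmbedding_apply,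
    Finset.card_map, Finset.card_range] at hwindow
  rw [Function.comp_apply, Complex.smul_re, smul_eq_mul, inv_mul_le_iff₀ (by exact_mod_cast hK)]
  exact hwindow

theorem re_inner_planeMul_le
    (hform : ∀ (ξ : Plane) (S : Finset ℤ) (a : ℤ → ℂ),
      (inner ℂ (∑ n ∈ S, a n • fourierBasis n)
        (circleMul Q (∑ n ∈ S, a n • fourierBasis n))).re ≤
        ∑ n ∈ S, A (ξ + (n : ℝ) • frequencyShift) * ‖a n‖ ^ 2)
    {w : L2Plane} (hA : Integrable fun ξ => A ξ * ‖(𝓕 w : L2Plane) ξ‖ ^ 2) :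
    (inner ℂ w (planeMul Q w)).re ≤ ∫ ξ, A ξ * ‖(𝓕 w : L2Plane) ξ‖ ^ 2 := by
  have hw : Integrable fun ξ => ‖(𝓕 w : L2Plane) ξ‖ ^ 2 :=
    (Lp.memLp (𝓕 w : L2Plane)).integrable_norm_pow two_ne_zero
  have happrox (δ : ℝ) (hδ : 0 < δ) : (inner ℂ w (planeMul Q w)).re ≤
      (∫ ξ, A ξ * ‖(𝓕 w : L2Plane) ξ‖ ^ 2) + δ * (2 * ‖w‖ ^ 2) := by
    obtain ⟨P, hP, hPQ⟩ := Metric.mem_closure_iff.1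
      (span_fourier_closure_eq_top.ge (Submodule.mem_top (x := Q))) δ hδ
    rw [dist_eq_norm] at hPQ
    have hAδ : Integrable fun ξ => (A ξ + δ) * ‖(𝓕 w : L2Plane) ξ‖ ^ 2 := by
      simp only [add_mul]
      exact hA.add (hw.const_mul δ)
    have hPform := re_inner_planeMul_le_of_mem_span hP (fun ξ S a => by
      simp only [add_mul, Finset.sum_add_distrib, ← Finset.mul_sum]
      rw [← norm_sq_sum_smul_basis (fourierBasis (T := 2 * Real.pi))]
      refine (re_inner_mulComp_le_add Q P _).trans (add_le_add (hform ξ S a) ?_)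
      rw [norm_sub_rev]
      gcongr) hAδ
    simp only [add_mul] at hPform
    rw [integral_add hA (hw.const_mul δ), integral_const_mul, integral_norm_sq_eq,
      Lp.norm_fourier_eq] at hPform
    have hQP : (inner ℂ w (planeMul Q w)).re ≤
        (inner ℂ w (planeMul P w)).re + ‖Q - P‖ * ‖w‖ ^ 2 := re_inner_mulComp_le_add P Q w
    have hδw : ‖Q - P‖ * ‖w‖ ^ 2 ≤ δ * ‖w‖ ^ 2 := by gcongr
    linarith
  have hlim : Tendsto (fun δ : ℝ => (∫ ξ, A ξ * ‖(𝓕 w : L2Plane) ξ‖ ^ 2) + δ * (2 * ‖w‖ ^ 2))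
      (𝓝[>] 0) (𝓝 (∫ ξ, A ξ * ‖(𝓕 w : L2Plane) ξ‖ ^ 2)) :=
    tendsto_nhdsWithin_of_tendsto_nhds <| Continuous.tendsto' (by fun_prop) _ _ (by simp)
  exact ge_of_tendsto hlim (eventually_mem_nhdsWithin.mono happrox)

end WindowTransfer

/-! ### The linearized semigroup -/

section LinearizedSemigroup

variable {s b ε ω κ : ℝ} {u : ℝ → ℝ}

theorem coeFn_planeMul_circlePotential (hu : Continuous u)
    (hper : Function.Periodic u (2 * Real.pi)) (w : L2Plane) :
    planeMul (circlePotential s b ε hu hper) w =ᵐ[volume]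
      fun z => (potential s b ε u (z 0) : ℂ) * w z := by
  simpa only [circlePotential_coe] using coeFn_planeMul (circlePotential s b ε hu hper) w

theorem norm_sq_eq_planeSymbol_sq_add_mul (hκ : 0 < κ) (v : L2Plane) :
    ∀ᵐ ξ, ‖(𝓕 v : L2Plane) ξ‖ ^ 2 =
      (planeSymbol ε ω ξ ^ 2 + κ) * ‖(𝓕 (planeN ε ω hκ v) : L2Plane) ξ‖ ^ 2 := by
  filter_upwards [fourier_planeN hκ v] with ξ hξ
  have hweight : (planeSymbol ε ω ξ ^ 2 + κ) * ‖planeWeight ε ω hκ ξ‖ ^ 2 = 1 := by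
    have h := congrArg norm (resolventWeight_sq_mul hκ (planeSymbol ε ω ξ))
    rw [norm_mul, norm_pow, ← Complex.ofReal_pow, ← Complex.ofReal_add, Complex.norm_real,
      Real.norm_of_nonneg (by positivity), norm_one, mul_comm] at h
    exact h
  rw [hξ, norm_mul, mul_pow, ← mul_assoc, hweight, one_mul]

variable (hu : Continuous u) (hper : Function.Periodic u (2 * Real.pi))

/-- The resolvent `(κ - ℒ)⁻¹` of the linearized operator. The value is junk unless `κ` is large. -/
def planeResolvent (s b ε ω : ℝ) (hκ : 0 < κ) : L2Plane →L[ℂ] L2Plane :=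
  perturbedResolvent (planeN ε ω hκ) (planeMul (circlePotential s b ε hu hper))

variable {hu hper}

theorem isStrictlyPositive_one_sub_plane (hκ : 0 < κ)
    (hVκ : ‖circlePotential s b ε hu hper‖ < κ) :
    IsStrictlyPositive (1 - planeN ε ω hκ * planeMul (circlePotential s b ε hu hper) *
      planeN ε ω hκ) :=
  isStrictlyPositive_one_sub_mul_mul (isSelfAdjoint_planeN hκ)
    (isSelfAdjoint_mulComp (conj_circlePotential hu hper)) (norm_planeN_sq_le hκ)
    ((norm_mulComp_le _).trans_lt hVκ)

theorem planeResolvent_nonneg (hκ : 0 < κ) (hVκ : ‖circlePotential s b ε hu hper‖ < κ) :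
    0 ≤ planeResolvent hu hper s b ε ω hκ :=
  perturbedResolvent_nonneg (isSelfAdjoint_planeN hκ) (isStrictlyPositive_one_sub_plane hκ hVκ)

theorem injective_planeResolvent (hκ : 0 < κ) (hVκ : ‖circlePotential s b ε hu hper‖ < κ) :
    Function.Injective (planeResolvent hu hper s b ε ω hκ) :=
  injective_perturbedResolvent (isStrictlyPositive_one_sub_plane hκ hVκ).isUnit
    (injective_planeN hκ)

theorem linearizedGraph_iff_eq_planeResolvent (hk : 0 < 1 + 2 * ε * ω) (hκ : 0 < κ)
    (hVκ : ‖circlePotential s b ε hu hper‖ < κ) {w g : L2Plane} :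
    LinearizedGraph s b ε ω u w g ↔
      w = planeResolvent hu hper s b ε ω hκ (κ • w - g) := by
  rw [linearizedGraph_iff (coeFn_planeMul_circlePotential hu hper) hk hκ, planeResolvent,
    eq_perturbedResolvent_iff (isStrictlyPositive_one_sub_plane hκ hVκ).isUnit]
  rfl

theorem norm_planeResolvent_le (hk : 0 < 1 + 2 * ε * ω) (hκ : 0 < κ)
    (hVκ : ‖circlePotential s b ε hu hper‖ < κ) :
    ‖planeResolvent hu hper s b ε ω hκ‖ ≤ (κ - maxGrowthRate s b ε ω u)⁻¹ := by
  have hgap : 0 < κ - maxGrowthRate s b ε ω u :=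
    sub_pos.2 ((maxGrowthRate_le_norm_circlePotential hk).trans_lt hVκ)
  refine (norm_perturbedResolvent_le_iff (isSelfAdjoint_planeN hκ)
    (isStrictlyPositive_one_sub_plane hκ hVκ) (inv_pos.2 hgap)).2 fun v => ?_
  let w := planeN ε ω hκ v
  let A : Plane → ℝ := fun ξ => planeSymbol ε ω ξ ^ 2 + maxGrowthRate s b ε ω u
  have hv : Integrable fun ξ => ‖(𝓕 v : L2Plane) ξ‖ ^ 2 :=
    (Lp.memLp (𝓕 v : L2Plane)).integrable_norm_pow two_ne_zero
  have hw : Integrable fun ξ => ‖(𝓕 w : L2Plane) ξ‖ ^ 2 :=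
    (Lp.memLp (𝓕 w : L2Plane)).integrable_norm_pow two_ne_zero
  have hA : (fun ξ => A ξ * ‖(𝓕 w : L2Plane) ξ‖ ^ 2) =ᵐ[volume] fun ξ =>
      ‖(𝓕 v : L2Plane) ξ‖ ^ 2 -
        (κ - maxGrowthRate s b ε ω u) * ‖(𝓕 w : L2Plane) ξ‖ ^ 2 := by
    filter_upwards [norm_sq_eq_planeSymbol_sq_add_mul hκ v] with ξ hξ
    rw [hξ]
    ring
  have hform : (inner ℂ w (planeMul (circlePotential s b ε hu hper) w)).re ≤
      ∫ ξ, A ξ * ‖(𝓕 w : L2Plane) ξ‖ ^ 2 :=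
    re_inner_planeMul_le (fun ξ S a => by
      simpa only [blochPoint_eq_add] using re_inner_circleMul_circlePotential_le hk
        (2 * Real.pi * ξ 0, 2 * Real.pi * ξ 1) S a)
      ((hv.sub (hw.const_mul _)).congr hA.symm)
  rw [integral_congr_ae hA, integral_sub hv (hw.const_mul _), integral_const_mul,
    integral_norm_sq_eq, integral_norm_sq_eq, Lp.norm_fourier_eq, Lp.norm_fourier_eq] at hform
  rw [inv_inv]
  linarith

theorem isLinearizedSemigroup_iff (hk : 0 < 1 + 2 * ε * ω) (hκ : 0 < κ)
    (hVκ : ‖circlePotential s b ε hu hper‖ < κ) {T : ℝ≥0 → L2Plane →L[ℂ] L2Plane} :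
    IsLinearizedSemigroup s b ε ω u T ↔ T = fun t : ℝ≥0 =>
      Real.exp (κ * t) • heatSemigroup (planeResolvent hu hper s b ε ω hκ) t := by
  have hR := planeResolvent_nonneg (ω := ω) hκ hVκ
  have hinj := injective_planeResolvent (ω := ω) hκ hVκ
  have hgraph (w g : L2Plane) := linearizedGraph_iff_eq_planeResolvent hk hκ hVκ (w := w) (g := g)
  constructor
  · rintro ⟨hT, hgen⟩
    exact funext (hT.eq_exp_smul_heatSemigroup hR hinj fun w g => (hgen w g).trans (hgraph w g))
  · rintro rfl
    exact ⟨(isC0Semigroup_heatSemigroup hR hinj).exp_smul κ, fun w g =>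
      (generatorGraph_exp_smul_heatSemigroup_iff hR hinj κ).trans (hgraph w g).symm⟩

theorem exists_linearizedSemigroup_mul_planeN_eq (hk : 0 < 1 + 2 * ε * ω) (hκ : 0 < κ)
    (hVκ : ‖circlePotential s b ε hu hper‖ < κ) {T : ℝ≥0 → L2Plane →L[ℂ] L2Plane}
    (hT : IsLinearizedSemigroup s b ε ω u T) :
    ∃ C : ℝ, ∀ t : ℝ≥0, ∃ B : L2Plane →L[ℂ] L2Plane,
      T t * planeN ε ω hκ = planeN ε ω hκ * B ∧
        ‖B‖ ≤ C * Real.exp (maxGrowthRate s b ε ω u * t) := by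
  obtain ⟨C, hC⟩ := exists_heatSemigroup_mul_eq (isSelfAdjoint_planeN hκ)
    (isStrictlyPositive_one_sub_plane hκ hVκ) (norm_planeResolvent_le hk hκ hVκ)
  refine ⟨C, fun t => ?_⟩
  obtain ⟨B, hB, hBC⟩ := hC t
  refine ⟨Real.exp (κ * t) • B, ?_, ?_⟩
  · rw [(isLinearizedSemigroup_iff hk hκ hVκ).1 hT, smul_mul_assoc, planeResolvent, hB,
      mul_smul_comm]
  · calc ‖Real.exp (κ * t) • B‖ = Real.exp (κ * t) * ‖B‖ := by
          rw [norm_smul, Real.norm_of_nonneg (Real.exp_nonneg _)]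
      _ ≤ Real.exp (κ * t) * (C * Real.exp (-(t / (κ - maxGrowthRate s b ε ω u)⁻¹))) := by gcongr
      _ = C * Real.exp (maxGrowthRate s b ε ω u * t) := by
          rw [mul_left_comm, ← Real.exp_add, div_inv_eq_mul]
          ring_nf

theorem IsLinearizedSemigroup.exists_normH_two_le (hu : Continuous u)
    (hper : Function.Periodic u (2 * Real.pi)) (hk : 0 < 1 + 2 * ε * ω)
    {T : ℝ≥0 → L2Plane →L[ℂ] L2Plane} (hT : IsLinearizedSemigroup s b ε ω u T) :
    ∃ C : ℝ, ∀ (t : ℝ≥0) (w : L2Plane), MemH 2 w → MemH 2 (T t w) ∧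
      normH 2 (T t w) ≤ C * Real.exp (maxGrowthRate s b ε ω u * t) * normH 2 w := by
  let κ := ‖circlePotential s b ε hu hper‖ + 1
  have hVκ : ‖circlePotential s b ε hu hper‖ < κ := lt_add_one _
  have hκ : 0 < κ := (norm_nonneg _).trans_lt hVκ
  obtain ⟨C, hC⟩ := exists_linearizedSemigroup_mul_planeN_eq hk hκ hVκ hT
  obtain ⟨C₁, hC₁⟩ := exists_eq_planeN_of_memH_two hk hκ
  obtain ⟨C₂, hC₂⟩ := exists_normH_planeN_le hk hκ
  refine ⟨|C₂| * C * C₁, fun t w hw => ?_⟩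
  obtain ⟨v, rfl, hv⟩ := hC₁ w hw
  obtain ⟨B, hB, hBC⟩ := hC t
  have hTv : T t (planeN ε ω hκ v) = planeN ε ω hκ (B v) := DFunLike.congr_fun hB v
  rw [hTv]
  refine ⟨(hC₂ (B v)).1, ?_⟩
  calc normH 2 (planeN ε ω hκ (B v)) ≤ C₂ * ‖B v‖ := (hC₂ (B v)).2
    _ ≤ |C₂| * (‖B‖ * ‖v‖) := by
        gcongr
        exacts [le_abs_self _, B.le_opNorm v]
    _ ≤ |C₂| * (C * Real.exp (maxGrowthRate s b ε ω u * t) *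
          (C₁ * normH 2 (planeN ε ω hκ v))) := by
        gcongr
        exact (norm_nonneg _).trans hBC
    _ = _ := by ring

theorem exists_isLinearizedSemigroup (hu : Continuous u)
    (hper : Function.Periodic u (2 * Real.pi)) (hk : 0 < 1 + 2 * ε * ω) :
    ∃ T, IsLinearizedSemigroup s b ε ω u T :=
  have hκ : 0 < ‖circlePotential s b ε hu hper‖ + 1 := by positivity
  ⟨_, (isLinearizedSemigroup_iff hk hκ (lt_add_one _)).2 rfl⟩

end LinearizedSemigroup

end SwiftHohenberg

end

open SwiftHohenberg in
theorem lemma3p2_general {s b ε ω : ℝ} (hk : 0 < 1 + 2 * ε * ω) {u : ℝ → ℝ} (hu : Continuous u)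
    (hper : Function.Periodic u (2 * Real.pi)) :
    IsLUB (blochEigenvalues s b ε ω u) (maxGrowthRate s b ε ω u) ∧
      (∃ T, IsLinearizedSemigroup s b ε ω u T) ∧
      ∀ T, IsLinearizedSemigroup s b ε ω u T →
        ∃ C : ℝ, ∀ (t : ℝ≥0) (w : L2Plane), MemH 2 w →
          MemH 2 (T t w) ∧
          normH 2 (T t w) ≤ C * Real.exp (maxGrowthRate s b ε ω u * t) * normH 2 w :=
  ⟨isLUB_maxGrowthRate hu hper hk, exists_isLinearizedSemigroup hu hper hk,
    fun _ hT => hT.exists_normH_two_le hu hper hk⟩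

theorem lemma3p2 (s b ε ω : ℝ) (hsb : 0 < 27 * s - 38 * b ^ 2) (hb : b ≠ 0)
    (hε : 0 < ε) (hω : ω ∈ Set.Ioo (-(1 / 2) : ℝ) (1 / 2)) (hk : 0 < 1 + 2 * ε * ω)
    (u : ℝ → ℝ) (hu : SwiftHohenberg.IsRoll s b ε ω u) :
    IsLUB (SwiftHohenberg.blochEigenvalues s b ε ω u)
        (SwiftHohenberg.maxGrowthRate s b ε ω u) ∧
      (∃ T, SwiftHohenberg.IsLinearizedSemigroup s b ε ω u T) ∧
      ∀ T, SwiftHohenberg.IsLinearizedSemigroup s b ε ω u T →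
        ∃ C : ℝ, ∀ (t : ℝ≥0) (w : SwiftHohenberg.L2Plane), SwiftHohenberg.MemH 2 w →
          SwiftHohenberg.MemH 2 (T t w) ∧
          SwiftHohenberg.normH 2 (T t w) ≤
            C * Real.exp (SwiftHohenberg.maxGrowthRate s b ε ω u * t) *
              SwiftHohenberg.normH 2 w :=
  lemma3p2_general hk hu.contDiff.continuous hu.periodic
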